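/- **Setting.** Let $\Bbbk$ be an algebraically closed field, $Q$ a finite quiver with vertex set $\mathbf N=\{1,\dots,n\}$, and $R$ a set of admissible relations on $Q$ (linear combinations of parallel paths of length at least $2$, such that the ideal $\langle R\rangle$ contains all sufficiently long paths), and let $A=\Bbbk Q/\langle R\rangle$. We regard algebras as $\Bbbk$-linear categories whose objects are the vertices. Let $\tilde A$ be given by the quiver obtained from $Q$ by adding, for every vertex $k$, a new vertex $\tilde k$ and one arrow $k\to\tilde k$, with the same relations $R$. Put $\tilde{\mathbf N}=\{\tilde 1,\dots,\tilde n\}$, $\overline{\mathbf N}=\mathbf N\cup\tilde{\mathbf N}$, let $I_m=\mathrm{Rad}^m\tilde A$ for $m\ge 0$, $I_m=\tilde A$ for $m<0$, and let $N$ be the nilpotency degree of $\mathrm{Rad}\,\tilde A$ (the least $N$ with $I_N=0$). **The algebra $\mathfrak D(\tilde A)$.** Let $\mathfrak B$ be the category with objects $x[i]$, $x\in\overline{\mathbf N}$, $i\in\mathbb Z$, and morphisms $\mathfrak B(x[i],y[j])=I_{j-i}(x,y)$, with the composition of $\tilde A$; let $\mathfrak I$ be its ideal $\mathfrak I(x[i],y[j])=I_{N-(i-j)}(x,y)$,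 and let $\mathfrak C=\mathfrak C(\tilde A)=\mathfrak B/\mathfrak I$. Let $\mathfrak D=\mathfrak D(\tilde A)$ be the trivial extension of $\mathfrak C$ by its restricted dual bimodule, that is, $\mathfrak D(\lambda,\mu)=\mathfrak C(\lambda,\mu)\oplus\mathrm{Hom}_{\Bbbk}(\mathfrak C(\mu,\lambda),\Bbbk)$; it is a symmetric algebra. **The orders.** In the first order, $x[i]>y[j]$ if $i>j$, or if $i=j$, $x\in\mathbf N$ and $y\in\tilde{\mathbf N}$. The second order is the opposite of the first one: $x[i]>y[j]$ if $i<j$, or if $i=j$, $x\in\tilde{\mathbf N}$ and $y\in\mathbf N$. **Quasi-hereditary.** Let $\mathcal D$ be a $\Bbbk$-linear category with a strict partial order on its objects. It is quasi-hereditary with respect to this order if 1. its objects have local endomorphism rings and are pairwise non-isomorphic, its morphism spaces are finite-dimensional, and for every object there are only finitely many objects with a nonzero morphism to it or from it; 2. for left $\mathcal D$-modules (covariant functors to $\Bbbk$-vector spaces), let $P(\lambda)=\mathcal D(\lambda,-)$ and let the standard module $\Delta(\lambda)$ be the quotient of $P(\lambda)$ by the trace of all $P(\nu)$ with $\nu\not\le\lambda$.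 Then for every $\lambda$ the simple top of $P(\lambda)$ has multiplicity one in $\Delta(\lambda)$, and the kernel of $P(\lambda)\twoheadrightarrow\Delta(\lambda)$ has a finite filtration with subquotients of the form $\Delta(\mu)$, $\mu>\lambda$; 3. the same holds for right $\mathcal D$-modules (contravariant functors). **Corollary 3.4.** The algebra $\mathfrak D(\tilde A)$ is quasi-hereditary with respect to the second order. -/

import Mathlib

open CategoryTheory Opposite

universe w v u

/-! ## Ideals and quotients of `k`-linear categories -/

/-- A two-sided ideal of a `k`-linear category. -/
structure LinIdeal (k : Type w) [Field k] (C : Type u) [Category.{v} C] [Preadditive C]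
    [Linear k C] where
  carrier : ∀ X Y : C, Submodule k (X ⟶ Y)
  comp_mem : ∀ {X Y Z : C} (f : X ⟶ Y) {g : Y ⟶ Z}, g ∈ carrier Y Z → f ≫ g ∈ carrier X Z
  mem_comp : ∀ {X Y Z : C} {f : X ⟶ Y} (g : Y ⟶ Z), f ∈ carrier X Y → f ≫ g ∈ carrier X Z

namespace LinIdeal

variable {k : Type w} [Field k] {C : Type u} [Category.{v} C] [Preadditive C] [Linear k C]

/-- The two-sided ideal generated by a family of sets of morphisms. -/
def gen (k : Type w) [Field k] {C : Type u} [Category.{v} C] [Preadditive C] [Linear k C]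
    (S : ∀ X Y : C, Set (X ⟶ Y)) : LinIdeal k C where
  carrier X Y := Submodule.span k
    {h | ∃ (A B : C) (f : X ⟶ A) (r : A ⟶ B) (g : B ⟶ Y), r ∈ S A B ∧ h = f ≫ r ≫ g}
  comp_mem {X Y Z} f g hg := by
    have := Submodule.mem_map_of_mem (f := Linear.leftComp k Z f) hg
    rw [Submodule.map_span] at this
    refine Submodule.span_mono ?_ this
    rintro _ ⟨_, ⟨A, B, a, r, b, hr, rfl⟩, rfl⟩
    exact ⟨A, B, f ≫ a, r, b, hr, by simp⟩
  mem_comp {X Y Z} f g hf := by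
    have := Submodule.mem_map_of_mem (f := Linear.rightComp k X g) hf
    rw [Submodule.map_span] at this
    refine Submodule.span_mono ?_ this
    rintro _ ⟨_, ⟨A, B, a, r, b, hr, rfl⟩, rfl⟩
    exact ⟨A, B, a, r, b ≫ g, hr, by simp⟩

/-- The objects of the quotient of a `k`-linear category by a two-sided ideal. -/
structure Quot (I : LinIdeal k C) where
  obj : C

/-- The composition of the quotient category, induced by that of `C`. -/
def Quot.comp (I : LinIdeal k C) (X Y Z : C) :
    ((X ⟶ Y) ⧸ I.carrier X Y) →ₗ[k] ((Y ⟶ Z) ⧸ I.carrier Y Z) →ₗ[k]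
      ((X ⟶ Z) ⧸ I.carrier X Z) :=
  (I.carrier X Y).liftQ
    { toFun := fun f => (I.carrier Y Z).mapQ (I.carrier X Z) (Linear.leftComp k Z f)
        fun _ hg => I.comp_mem f hg
      map_add' := fun f f' => by
        apply Submodule.linearMap_qext
        ext g
        exact congrArg Submodule.Quotient.mk (Preadditive.add_comp _ _ _ f f' g)
      map_smul' := fun r f => by
        apply Submodule.linearMap_qext
        ext g
        exact congrArg Submodule.Quotient.mk (Linear.smul_comp _ _ _ r f g) }
    (fun f hf => by
      rw [LinearMap.mem_ker]
      apply Submodule.linearMap_qext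
      ext g
      exact (Submodule.Quotient.mk_eq_zero _).2 (I.mem_comp g hf))

instance (I : LinIdeal k C) : Category.{v} I.Quot where
  Hom X Y := (X.obj ⟶ Y.obj) ⧸ I.carrier X.obj Y.obj
  id X := Submodule.Quotient.mk (𝟙 X.obj)
  comp {X Y Z} f g := Quot.comp I X.obj Y.obj Z.obj f g
  id_comp {X Y} f := by
    induction f using Submodule.Quotient.induction_on with
    | H f => exact congrArg Submodule.Quotient.mk (Category.id_comp f)
  comp_id {X Y} f := by
    induction f using Submodule.Quotient.induction_on with
    | H f => exact congrArg Submodule.Quotient.mk (Category.comp_id f)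
  assoc {W X Y Z} f g h := by
    induction f using Submodule.Quotient.induction_on with
    | H f =>
      induction g using Submodule.Quotient.induction_on with
      | H g =>
        induction h using Submodule.Quotient.induction_on with
        | H h => exact congrArg Submodule.Quotient.mk (Category.assoc f g h)

instance (I : LinIdeal k C) : Preadditive I.Quot where
  homGroup X Y := inferInstanceAs (AddCommGroup ((X.obj ⟶ Y.obj) ⧸ I.carrier X.obj Y.obj))
  add_comp X Y Z f f' g := LinearMap.congr_fun ((Quot.comp I X.obj Y.obj Z.obj).map_add f f') g
  comp_add X Y Z f g g' := (Quot.comp I X.obj Y.obj Z.obj f).map_add g g'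

instance (I : LinIdeal k C) : Linear k I.Quot where
  homModule X Y := inferInstanceAs (Module k ((X.obj ⟶ Y.obj) ⧸ I.carrier X.obj Y.obj))
  smul_comp X Y Z r f g := LinearMap.congr_fun ((Quot.comp I X.obj Y.obj Z.obj).map_smul r f) g
  comp_smul X Y Z f r g := (Quot.comp I X.obj Y.obj Z.obj f).map_smul r g

end LinIdeal

/-! ## Multiplicative filtrations by ideals; the radical filtration -/

/-- A decreasing filtration `C = I₀ ⊇ I₁ ⊇ I₂ ⊇ ⋯` by two-sided ideals with
`I_a I_b ⊆ I_{a+b}` (being an ideal is the case `a = 0` or `b = 0`). -/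
structure IdealFiltration (k : Type w) [Field k] (C : Type u) [Category.{v} C] [Preadditive C]
    [Linear k C] where
  ideal : ℕ → ∀ X Y : C, Submodule k (X ⟶ Y)
  zero : ∀ X Y : C, ideal 0 X Y = ⊤
  anti : ∀ {a b : ℕ}, a ≤ b → ∀ X Y : C, ideal b X Y ≤ ideal a X Y
  mul : ∀ (a b : ℕ) {X Y Z : C} {f : X ⟶ Y} {g : Y ⟶ Z},
    f ∈ ideal a X Y → g ∈ ideal b Y Z → f ≫ g ∈ ideal (a + b) X Z

section Radical

variable (k : Type w) [Field k] {C : Type u} [Category.{v} C] [Preadditive C] [Linear k C]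

/-- The Jacobson radical of a `k`-linear category: `f : X ⟶ Y` belongs to it iff for all
`g : Y ⟶ X` the composite `X ⟶ Y ⟶ X` lies in the Jacobson radical of the ring `End X`. -/
def catRadical (X Y : C) : Submodule k (X ⟶ Y) where
  carrier := {f | ∀ g : Y ⟶ X, (show End X from f ≫ g) ∈ Ring.jacobson (End X)}
  add_mem' {f f'} hf hf' g := by
    have h : (f + f') ≫ g = f ≫ g + f' ≫ g := Preadditive.add_comp _ _ _ _ _ _
    rw [h]
    exact Submodule.add_mem _ (hf g) (hf' g)
  zero_mem' g := by
    have h : (0 : X ⟶ Y) ≫ g = 0 := Limits.zero_comp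
    rw [h]
    exact Submodule.zero_mem _
  smul_mem' r f hf g := by
    have h : (r • f) ≫ g = f ≫ (r • g) := by simp
    rw [h]
    exact hf _

/-- The powers of the radical: `Rad⁰` is everything, and `Rad^{m+1}` is spanned by the composites
of a morphism of `Rad^m` and a morphism of `Rad`. -/
def radPow : ℕ → ∀ X Y : C, Submodule k (X ⟶ Y)
  | 0, _, _ => ⊤
  | m + 1, X, Y => Submodule.span k
      {h | ∃ (Z : C) (f : X ⟶ Z) (g : Z ⟶ Y), f ∈ radPow m X Z ∧ g ∈ catRadical k Z Y ∧ h = f ≫ g}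

variable {k}

theorem comp_mem_catRadical {X Y Z : C} {f : X ⟶ Y} (g : Y ⟶ Z) (hf : f ∈ catRadical k X Y) :
    f ≫ g ∈ catRadical k X Z := by
  intro h
  have : (f ≫ g) ≫ h = f ≫ (g ≫ h) := Category.assoc _ _ _
  rw [this]
  exact hf _

theorem radPow_mul_zero (a : ℕ) {X Y Z : C} {f : X ⟶ Y} (g : Y ⟶ Z)
    (hf : f ∈ radPow k a X Y) : f ≫ g ∈ radPow k a X Z := by
  cases a with
  | zero => exact Submodule.mem_top
  | succ a =>
    have := Submodule.mem_map_of_mem (f := Linear.rightComp k X g) hf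
    rw [radPow, Submodule.map_span] at this
    refine Submodule.span_mono ?_ this
    rintro _ ⟨_, ⟨W, p, q, hp, hq, rfl⟩, rfl⟩
    exact ⟨W, p, q ≫ g, hp, comp_mem_catRadical g hq, by simp⟩

theorem radPow_mul (a b : ℕ) {X Y Z : C} {f : X ⟶ Y} {g : Y ⟶ Z}
    (hf : f ∈ radPow k a X Y) (hg : g ∈ radPow k b Y Z) : f ≫ g ∈ radPow k (a + b) X Z := by
  induction b generalizing Z with
  | zero => exact radPow_mul_zero a g hf
  | succ b ih =>
    have := Submodule.mem_map_of_mem (f := Linear.leftComp k Z f) hg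
    rw [radPow, Submodule.map_span] at this
    refine Submodule.span_mono ?_ this
    rintro _ ⟨_, ⟨W, p, q, hp, hq, rfl⟩, rfl⟩
    exact ⟨W, f ≫ p, q, ih hp, hq, by simp⟩

theorem radPow_anti {a b : ℕ} (h : a ≤ b) (X Y : C) : radPow k b X Y ≤ radPow k a X Y := by
  induction h with
  | refl => exact le_rfl
  | @step m _ ih =>
    refine le_trans (Submodule.span_le.2 ?_) ih
    rintro _ ⟨W, p, q, hp, -, rfl⟩
    exact radPow_mul_zero m q hp

variable (k C)

/-- The radical filtration of a `k`-linear category. -/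
def radFiltration : IdealFiltration k C where
  ideal := radPow k
  zero _ _ := rfl
  anti h := radPow_anti h
  mul a b _ _ _ _ _ hf hg := radPow_mul a b hf hg

end Radical

/-! ## The category `ℭ = 𝔅 / ℑ` of a filtered category -/

namespace IdealFiltration

variable {k : Type w} [Field k] {C : Type u} [Category.{v} C] [Preadditive C] [Linear k C]

/-- The objects `x[i]` of the category `𝔅`. -/
structure BObj (F : IdealFiltration k C) where
  obj : C
  idx : ℤ

/-- The morphisms `x[i] ⟶ y[j]` of `𝔅`: all morphisms `x ⟶ y` if `i ≥ j` (as then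
`(j - i).toNat = 0`), and those of `I_{j-i}` if `i < j`. -/
def bHom (F : IdealFiltration k C) (X Y : F.BObj) : Submodule k (X.obj ⟶ Y.obj) :=
  F.ideal (Y.idx - X.idx).toNat X.obj Y.obj

theorem bHom_of_ge (F : IdealFiltration k C) {X Y : F.BObj} (h : Y.idx ≤ X.idx) :
    F.bHom X Y = ⊤ := by
  have h0 : (Y.idx - X.idx).toNat = 0 := by omega
  rw [bHom, h0, F.zero]

instance (F : IdealFiltration k C) : Category.{v} F.BObj where
  Hom X Y := F.bHom X Y
  id X := ⟨𝟙 X.obj, by rw [F.bHom_of_ge le_rfl]; exact Submodule.mem_top⟩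
  comp {X Y Z} f g := ⟨f.1 ≫ g.1, F.anti (by omega) _ _ (F.mul _ _ f.2 g.2)⟩
  id_comp f := Subtype.ext (Category.id_comp f.1)
  comp_id f := Subtype.ext (Category.comp_id f.1)
  assoc f g h := Subtype.ext (Category.assoc f.1 g.1 h.1)

instance (F : IdealFiltration k C) : Preadditive F.BObj where
  homGroup X Y := inferInstanceAs (AddCommGroup (F.bHom X Y))
  add_comp _ _ _ f f' g := Subtype.ext (Preadditive.add_comp _ _ _ f.1 f'.1 g.1)
  comp_add _ _ _ f g g' := Subtype.ext (Preadditive.comp_add _ _ _ f.1 g.1 g'.1)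

instance (F : IdealFiltration k C) : Linear k F.BObj where
  homModule X Y := inferInstanceAs (Module k (F.bHom X Y))
  smul_comp _ _ _ r f g := Subtype.ext (Linear.smul_comp _ _ _ r f.1 g.1)
  comp_smul _ _ _ f r g := Subtype.ext (Linear.comp_smul _ _ _ f.1 r g.1)

/-- The ideal `ℑ` of `𝔅`, for a filtration with `I_N = 0`. Its morphisms `x[i] ⟶ y[j]` are those
of `I_{N-(i-j)}` for `i - N < j < i`, all of them for `j ≤ i - N` (as then the exponent is cut off
at `0`), and only zero for `j ≥ i` (as then the exponent is at least `N`). -/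
def bIdeal (F : IdealFiltration k C) (N : ℕ) : LinIdeal k F.BObj where
  carrier X Y := Submodule.comap (F.bHom X Y).subtype
    (F.ideal ((N : ℤ) - (X.idx - Y.idx)).toNat X.obj Y.obj)
  comp_mem {X Y Z} f g hg := F.anti (by omega) _ _ (F.mul _ _ f.2 hg)
  mem_comp {X Y Z} f g hf := F.anti (by omega) _ _ (F.mul _ _ hf g.2)

/-- The category `ℭ = 𝔅 / ℑ`. -/
abbrev CCat (F : IdealFiltration k C) (N : ℕ) := (F.bIdeal N).Quot

end IdealFiltration

/-! ## Trivial extensions -/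

/-- The trivial extension `C ⋉ C^*` of a `k`-linear category by its restricted dual bimodule. -/
structure TrivExt (k : Type w) (C : Type u) where
  obj : C

namespace TrivExt

variable {k : Type w} [Field k] {C : Type u} [Category.{v} C] [Preadditive C] [Linear k C]

/-- A morphism `X ⟶ Y` is a pair of a morphism of `C` and a linear form on `C(Y, X)`. Composition is
that of `C` together with the bimodule structure `(φ · g)(h) = φ (g ≫ h)`,
`(f · ψ)(h) = ψ (h ≫ f)` of the dual, the product of two linear forms being zero. -/
instance : Category.{max v w} (TrivExt k C) where
  Hom X Y := (X.obj ⟶ Y.obj) × Module.Dual k (Y.obj ⟶ X.obj)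
  id X := (𝟙 X.obj, 0)
  comp {X Y Z} f g := (f.1 ≫ g.1, f.2 ∘ₗ Linear.leftComp k X.obj g.1 +
    g.2 ∘ₗ Linear.rightComp k Z.obj f.1)
  id_comp {X Y} f := by
    refine Prod.ext (Category.id_comp _) (LinearMap.ext fun h => ?_)
    simp
  comp_id {X Y} f := by
    refine Prod.ext (Category.comp_id _) (LinearMap.ext fun h => ?_)
    simp
  assoc {W X Y Z} f g h := by
    refine Prod.ext (Category.assoc _ _ _) (LinearMap.ext fun a => ?_)
    simp [add_assoc]

instance : Preadditive (TrivExt k C) where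
  homGroup X Y := inferInstanceAs
    (AddCommGroup ((X.obj ⟶ Y.obj) × Module.Dual k (Y.obj ⟶ X.obj)))
  add_comp X Y Z f f' g := by
    refine Prod.ext (Preadditive.add_comp _ _ _ _ _ _) (LinearMap.ext fun h => ?_)
    change (f.2 + f'.2) (g.1 ≫ h) + g.2 (h ≫ (f.1 + f'.1)) =
      f.2 (g.1 ≫ h) + g.2 (h ≫ f.1) + (f'.2 (g.1 ≫ h) + g.2 (h ≫ f'.1))
    simp only [LinearMap.add_apply, Preadditive.comp_add, map_add]
    abel
  comp_add X Y Z f g g' := by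
    refine Prod.ext (Preadditive.comp_add _ _ _ _ _ _) (LinearMap.ext fun h => ?_)
    change f.2 ((g.1 + g'.1) ≫ h) + (g.2 + g'.2) (h ≫ f.1) =
      f.2 (g.1 ≫ h) + g.2 (h ≫ f.1) + (f.2 (g'.1 ≫ h) + g'.2 (h ≫ f.1))
    simp only [LinearMap.add_apply, Preadditive.add_comp, map_add]
    abel

instance : Linear k (TrivExt k C) where
  homModule X Y := inferInstanceAs
    (Module k ((X.obj ⟶ Y.obj) × Module.Dual k (Y.obj ⟶ X.obj)))
  smul_comp X Y Z r f g := by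
    refine Prod.ext (Linear.smul_comp _ _ _ _ _ _) (LinearMap.ext fun h => ?_)
    change (r • f.2) (g.1 ≫ h) + g.2 (h ≫ (r • f.1)) =
      r • (f.2 (g.1 ≫ h) + g.2 (h ≫ f.1))
    simp [mul_add]
  comp_smul X Y Z f r g := by
    refine Prod.ext (Linear.comp_smul _ _ _ _ _ _) (LinearMap.ext fun h => ?_)
    change f.2 ((r • g.1) ≫ h) + (r • g.2) (h ≫ f.1) =
      r • (f.2 (g.1 ≫ h) + g.2 (h ≫ f.1))
    simp [mul_add]

end TrivExt

/-! ## Quasi-hereditary categories -/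

/-- The opposite of a `k`-linear category is `k`-linear. -/
instance oppositeLinear (k : Type w) [Field k] (C : Type u) [Category.{v} C] [Preadditive C]
    [Linear k C] : Linear k Cᵒᵖ where
  homModule X Y := Equiv.module k (opEquiv X Y)
  smul_comp _ _ _ r f g := Quiver.Hom.unop_inj (Linear.comp_smul _ _ _ g.unop r f.unop)
  comp_smul _ _ _ f r g := Quiver.Hom.unop_inj (Linear.smul_comp _ _ _ r g.unop f.unop)

section QuasiHereditary

variable (k : Type w) [Field k] {D : Type u} [Category.{v} D] [Preadditive D] [Linear k D]

/-- The two-sided ideal generated by the identities of the objects `ν` that are not `≤ l`, where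
`lt` is the strict order on objects. -/
def notLeIdeal (lt : D → D → Prop) (l : D) : LinIdeal k D :=
  LinIdeal.gen k fun X Y => {f | ¬ (X = l ∨ lt X l) ∧ ∃ h : X = Y, f = eqToHom h}

/-- The standard left module at `l`: the functor `D(l, -)`, which is the indecomposable projective
module at `l`, modulo the trace of the projectives at all objects that are not `≤ l`. It is the
largest quotient of `D(l, -)` whose composition factors are all indexed by objects `≤ l`. -/
def stdModule (lt : D → D → Prop) (l : D) : D ⥤ ModuleCat.{v} k where
  obj X := ModuleCat.of k ((l ⟶ X) ⧸ (notLeIdeal k lt l).carrier l X)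
  map {X Y} g := ModuleCat.ofHom (((notLeIdeal k lt l).carrier l X).mapQ
    ((notLeIdeal k lt l).carrier l Y) (Linear.rightComp k l g)
    fun _ hf => (notLeIdeal k lt l).mem_comp g hf)
  map_id X := by
    apply ModuleCat.hom_ext
    apply Submodule.linearMap_qext
    ext f
    exact congrArg Submodule.Quotient.mk (Category.comp_id f)
  map_comp {X Y Z} g h := by
    apply ModuleCat.hom_ext
    apply Submodule.linearMap_qext
    ext f
    exact congrArg Submodule.Quotient.mk (Category.assoc f g h).symm

/-- The canonical projection from the projective module at `l` to the standard module at `l`. -/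
def stdProj (lt : D → D → Prop) (l : D) :
    (linearCoyoneda k D).obj (op l) ⟶ stdModule k lt l where
  app X := ModuleCat.ofHom ((notLeIdeal k lt l).carrier l X).mkQ
  naturality {X Y} g := by
    apply ModuleCat.hom_ext
    ext f
    rfl

/-- `IsStdFiltered k lt p M`: the module `M` has a finite filtration whose subquotients are standard
modules at objects `m` that satisfy `p m`. -/
inductive IsStdFiltered (lt : D → D → Prop) (p : D → Prop) : (D ⥤ ModuleCat.{v} k) → Prop
  | zero (M : D ⥤ ModuleCat.{v} k) (hM : Limits.IsZero M) : IsStdFiltered lt p M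
  | ext (S : ShortComplex (D ⥤ ModuleCat.{v} k)) (hS : S.ShortExact) (m : D) (hm : p m)
      (e : S.X₃ ≅ stdModule k lt m) (h : IsStdFiltered lt p S.X₁) : IsStdFiltered lt p S.X₂

/-- The condition on left modules in the definition of quasi-hereditary: for every `l`, the simple
module at `l` occurs exactly once in the standard module at `l`, and the kernel of the projection
from the projective at `l` to the standard module at `l` has a finite filtration by standard modules
at objects `m > l`. -/
def HasStandardFiltrationsLeft (lt : D → D → Prop) : Prop :=
  ∀ l : D, Module.finrank k ((stdModule k lt l).obj l) = 1 ∧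
    IsStdFiltered k lt (fun m => lt l m) (Limits.kernel (stdProj k lt l))

variable (D)

/-- Finite-dimensional projectives and injectives, and basic: the objects have local endomorphism
rings and are pairwise non-isomorphic. -/
structure IsBasicLocallyBounded : Prop where
  isLocalRing_end : ∀ X : D, IsLocalRing (End X)
  eq_of_iso : ∀ X Y : D, Nonempty (X ≅ Y) → X = Y
  finite_hom : ∀ X Y : D, FiniteDimensional k (X ⟶ Y)
  finite_from : ∀ X : D, {Y : D | Nontrivial (X ⟶ Y)}.Finite
  finite_to : ∀ Y : D, {X : D | Nontrivial (X ⟶ Y)}.Finite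

/-- A `k`-linear category `D` (over an algebraically closed field `k`) is quasi-hereditary with
respect to the strict partial order `lt` on its objects. The condition on standard modules is
required of left modules (covariant functors) and of right modules (left modules over `Dᵒᵖ`). -/
structure IsQuasiHereditary (lt : D → D → Prop) : Prop where
  basic : IsBasicLocallyBounded k D
  order : IsStrictOrder D lt
  left : HasStandardFiltrationsLeft k lt
  right : HasStandardFiltrationsLeft (D := Dᵒᵖ) k fun X Y => lt X.unop Y.unop

end QuasiHereditary

/-! ## Quivers with relations -/

section QuiverRelations

variable (k : Type w) [Field k] (V : Type u) [Quiver.{v} V]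

/-- A set of relations on a quiver: a set of linear combinations of parallel paths. -/
abbrev QuiverRelations := ∀ x y : V, Set (Quiver.Path x y →₀ k)

variable {k V}

/-- The ideal of the path category `kQ` generated by the relations. -/
noncomputable def QuiverRelations.ideal (R : QuiverRelations k V) : LinIdeal k (Free k (Paths V)) :=
  LinIdeal.gen k fun x y => R x y

/-- The `k`-linear category `kQ / ⟨R⟩` given by the quiver with relations. -/
abbrev QuiverRelations.Cat (R : QuiverRelations k V) := R.ideal.Quot

/-- The relations are admissible: they are combinations of paths of length at least two, and the
ideal that they generate contains all sufficiently long paths. -/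
def QuiverRelations.IsAdmissible (R : QuiverRelations k V) : Prop :=
  (∀ (x y : V), ∀ r ∈ R x y, ∀ p ∈ r.support, 2 ≤ p.length) ∧
    ∃ m : ℕ, ∀ (x y : V) (p : Quiver.Path x y), m ≤ p.length →
      (Finsupp.single p 1 : Quiver.Path x y →₀ k) ∈ R.ideal.carrier x y

/-- The vertices of the extended quiver: the old vertices `x` and the new vertices `x̃`. -/
inductive TildeVertex (V : Type u) : Type u
  | old (x : V) : TildeVertex V
  | new (x : V) : TildeVertex V

/-- The arrows of the extended quiver: the old arrows and one new arrow `x ⟶ x̃` for each `x`. -/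
inductive TildeArrow (V : Type u) [Quiver.{v} V] :
    TildeVertex V → TildeVertex V → Type (max u v)
  | old {x y : V} (a : x ⟶ y) : TildeArrow V (.old x) (.old y)
  | new (x : V) : TildeArrow V (.old x) (.new x)

instance : Quiver.{max u v} (TildeVertex V) where
  Hom := TildeArrow V

/-- The inclusion of the quiver into the extended quiver. -/
def tildeInclusion (V : Type u) [Quiver.{v} V] : V ⥤q TildeVertex V where
  obj x := .old x
  map a := TildeArrow.old a

/-- The relations on the extended quiver: the original ones. -/
inductive QuiverRelations.TildeRel (R : QuiverRelations k V) :
    ∀ X Y : TildeVertex V, (Quiver.Path X Y →₀ k) → Prop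
  | old {x y : V} (r : Quiver.Path x y →₀ k) (hr : r ∈ R x y) :
      TildeRel R (.old x) (.old y) (r.mapDomain fun p => (tildeInclusion V).mapPath p)

/-- The relations on the extended quiver, as a family of sets. -/
def QuiverRelations.tilde (R : QuiverRelations k V) : QuiverRelations k (TildeVertex V) :=
  fun X Y => {r | R.TildeRel X Y r}

/-- The category `Ã`. -/
abbrev QuiverRelations.ACatTilde (R : QuiverRelations k V) := R.tilde.Cat

/-- The category `𝔇(Ã)`, the trivial extension of `ℭ(Ã)` for the radical filtration of `Ã`; here
`N` is to be the nilpotency degree of the radical of `Ã`. -/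
abbrev QuiverRelations.DCat (R : QuiverRelations k V) (N : ℕ) :=
  TrivExt k ((radFiltration k R.ACatTilde).CCat N)

/-- The vertex `x` of an object `x[i]` of `𝔇(Ã)`. -/
def QuiverRelations.DCat.vertex {R : QuiverRelations k V} {N : ℕ} (X : R.DCat N) :
    TildeVertex V := X.obj.obj.obj.obj

/-- The index `i` of an object `x[i]` of `𝔇(Ã)`. -/
def QuiverRelations.DCat.index {R : QuiverRelations k V} {N : ℕ} (X : R.DCat N) : ℤ :=
  X.obj.obj.idx

/-- The first order: `Y[j] < X[i]` if `j < i`, or if `i = j`, `X` is an old vertex, and `Y` is a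
new vertex. -/
def QuiverRelations.firstLT (R : QuiverRelations k V) (N : ℕ) (Y X : R.DCat N) : Prop :=
  DCat.index Y < DCat.index X ∨
    (DCat.index Y = DCat.index X ∧ (∃ x, DCat.vertex X = .old x) ∧ ∃ y, DCat.vertex Y = .new y)

/-- The second order is the opposite of the first one. -/
def QuiverRelations.secondLT (R : QuiverRelations k V) (N : ℕ) (Y X : R.DCat N) : Prop :=
  R.firstLT N X Y

end QuiverRelations

-- In `𝔇(Ã)` a smaller index means a larger object, and everything is controlled by the maps x[i] ⟶
-- x[j], j ≤ i, induced by identities (`shift`). The argument uses only the facts collected in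
-- `IsTildeLike`. The decisive ones are that I_N = 0 and that I_{N-1} vanishes into old vertices and
-- out of new ones. The first half of this vanishing is the role of the new arrows: composing with x
-- ⟶ x̃ is injective, and it sends I_{N-1} into I_N = 0 (`eq_zero_of_comp_newArrow`).
--
-- Left modules: the kernel of D(x[i], -) ⟶ Δ(x[i]) is generated by the single map x[i] ⟶ x[i-1]
-- (`mem_notLeIdeal_left`). The submodules generated by x[i] ⟶ x[j] form a chain reaching 0 at j = i
-- - N. Its layers are standard, because a map out of x[j] killed by x[i] ⟶ x[j] factors through
-- x[j] ⟶ x[j-1]. So D(x[i], -) has the layers Δ(x[i]), Δ(x[i-1]), …, Δ(x[i-N+1]).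
--
-- Right modules: a morphism into x[i] lies in the trace iff its ℭ-component is represented in I_1
-- (`mem_notLeIdeal_right`). Hence the right standard module at x[i] is one-dimensional at x[i], …,
-- x[i+N-1] and zero elsewhere. The projective D(-, x[i]) is an extension of ℭ(-, x[i]) by the dual
-- part. Both have the form y[j] ↦ M_{i-j}(y) / M_{N-(j-i)}(y) for a filtered right Ã-module M:
-- either Ã(-, x) with the radical filtration, or Ã(x, -)^* filtered by the annihilators of I_{N-s}.
-- After refining M to one-dimensional steps, each new vector of M_s(u) contributes exactly the
-- standard module at u[i-s] (`isStdFiltered_step`). For s > 0 this is larger than x[i]. For s = 0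
-- only the dual part enters the kernel, and a vector of M_0(u) outside M_1(u) detects a nonzero
-- element of I_{N-1}(x, u), which forces x old and u new.

universe t

/-! ## Submodules of projective modules and standard filtrations -/

section StandardFiltrations

variable {k : Type w} [Field k] {D : Type u} [Category.{v} D] [Preadditive D] [Linear k D]

/-- A submodule of the projective left module `D(l, -)`. -/
@[ext]
structure ProjSub (k : Type w) [Field k] {D : Type u} [Category.{v} D] [Preadditive D]
    [Linear k D] (l : D) where
  carrier : ∀ X : D, Submodule k (l ⟶ X)
  comp_mem : ∀ {X Y : D} {f : l ⟶ X} (g : X ⟶ Y), f ∈ carrier X → f ≫ g ∈ carrier Y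

namespace ProjSub

variable {l : D}

/-- The functor given by a submodule of `D(l, -)`. -/
def toFunctor (S : ProjSub k l) : D ⥤ ModuleCat.{v} k where
  obj X := ModuleCat.of k (S.carrier X)
  map {X Y} g := ModuleCat.ofHom ((Linear.rightComp k l g).restrict fun _ hf => S.comp_mem g hf)
  map_id X := by
    apply ModuleCat.hom_ext
    ext f
    exact Category.comp_id f.1
  map_comp {X Y Z} g h := by
    apply ModuleCat.hom_ext
    ext f
    exact (Category.assoc f.1 g h).symm

/-- The inclusion of a submodule of `D(l, -)` into a larger one. -/
def incl {S' S : ProjSub k l} (h : ∀ X, S'.carrier X ≤ S.carrier X) :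
    S'.toFunctor ⟶ S.toFunctor where
  app X := ModuleCat.ofHom (Submodule.inclusion (h X))
  naturality {X Y} g := by
    apply ModuleCat.hom_ext
    ext f
    rfl

/-- The quotient map `S ⟶ Δ(m)` with kernel `S'`, when `S` is generated over `S'` by an element
whose annihilator modulo `S'` is that of the generator of `Δ(m)`. -/
noncomputable def toStd {lt : D → D → Prop} {S' S : ProjSub k l} {m : D} (v : l ⟶ m)
    (hspan : ∀ (X : D) (f : l ⟶ X), f ∈ S.carrier X → ∃ g : m ⟶ X, f - v ≫ g ∈ S'.carrier X)
    (hann : ∀ (X : D) (g : m ⟶ X), v ≫ g ∈ S'.carrier X → g ∈ (notLeIdeal k lt m).carrier m X) :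
    S.toFunctor ⟶ stdModule k lt m :=
  -- The chosen `g` does not matter: two choices differ by an element that sends `v` into `S'`, and
  -- `hann` makes it zero in `Δ(m)`.
  have key : ∀ (X : D) (f : S.carrier X) (g : m ⟶ X), f.1 - v ≫ g ∈ S'.carrier X →
      ((notLeIdeal k lt m).carrier m X).mkQ (hspan X f.1 f.2).choose =
        ((notLeIdeal k lt m).carrier m X).mkQ g := by
    intro X f g hg
    refine (Submodule.Quotient.eq _).2 (hann X _ ?_)
    have := Submodule.sub_mem _ hg (hspan X f.1 f.2).choose_spec
    rwa [sub_sub_sub_cancel_left, ← Preadditive.comp_sub] at this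
  { app := fun X => ModuleCat.ofHom
      { toFun := fun f => ((notLeIdeal k lt m).carrier m X).mkQ (hspan X f.1 f.2).choose
        map_add' := fun f f' => by
          rw [← map_add]
          refine key X _ _ ?_
          have := Submodule.add_mem _ (hspan X f.1 f.2).choose_spec (hspan X f'.1 f'.2).choose_spec
          rwa [sub_add_sub_comm, ← Preadditive.comp_add] at this
        map_smul' := fun r f => by
          rw [RingHom.id_apply, ← map_smul]
          refine key X _ _ ?_
          have := Submodule.smul_mem _ r (hspan X f.1 f.2).choose_spec
          rwa [smul_sub, ← Linear.comp_smul] at this }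
    naturality := fun X Y g => by
      apply ModuleCat.hom_ext
      ext f
      refine key Y _ _ ?_
      have := S'.comp_mem g (hspan X f.1 f.2).choose_spec
      rw [Preadditive.sub_comp, Category.assoc] at this
      exact this }

theorem toStd_eq {lt : D → D → Prop} {S' S : ProjSub k l} {m : D} (v : l ⟶ m)
    (hspan : ∀ (X : D) (f : l ⟶ X), f ∈ S.carrier X → ∃ g : m ⟶ X, f - v ≫ g ∈ S'.carrier X)
    (hann : ∀ (X : D) (g : m ⟶ X), v ≫ g ∈ S'.carrier X → g ∈ (notLeIdeal k lt m).carrier m X)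
    (X : D) (f : S.carrier X) (g : m ⟶ X) (hg : f.1 - v ≫ g ∈ S'.carrier X) :
    ((toStd v hspan hann).app X).hom f = ((notLeIdeal k lt m).carrier m X).mkQ g := by
  refine (Submodule.Quotient.eq _).2 (hann X _ ?_)
  have := Submodule.sub_mem _ hg (hspan X f.1 f.2).choose_spec
  rwa [sub_sub_sub_cancel_left, ← Preadditive.comp_sub] at this

/-- One step of a standard filtration inside a projective module. -/
theorem isStdFiltered_of_generator {lt : D → D → Prop} {p : D → Prop} {S' S : ProjSub k l}
    (hle : ∀ X, S'.carrier X ≤ S.carrier X) {m : D} (hm : p m) (v : l ⟶ m)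
    (hv : v ∈ S.carrier m)
    (hspan : ∀ (X : D) (f : l ⟶ X), f ∈ S.carrier X → ∃ g : m ⟶ X, f - v ≫ g ∈ S'.carrier X)
    (hann : ∀ (X : D) (g : m ⟶ X),
      v ≫ g ∈ S'.carrier X ↔ g ∈ (notLeIdeal k lt m).carrier m X)
    (h : IsStdFiltered k lt p S'.toFunctor) : IsStdFiltered k lt p S.toFunctor := by
  let π := toStd (lt := lt) v hspan fun X g => (hann X g).1
  have hπ := toStd_eq (lt := lt) v hspan fun X g => (hann X g).1
  have hzero : ∀ (X : D) (f : S.carrier X), (π.app X).hom f = 0 ↔ f.1 ∈ S'.carrier X := by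
    intro X f
    obtain ⟨g, hg⟩ := hspan X f.1 f.2
    rw [hπ X f g hg]
    refine (Submodule.Quotient.mk_eq_zero _).trans ((hann X g).symm.trans ?_)
    exact ⟨fun h => by simpa using Submodule.add_mem _ hg h,
      fun h => by simpa using Submodule.sub_mem _ h hg⟩
  have w : incl hle ≫ π = 0 := by
    ext X f
    exact (hzero X _).2 f.2
  have : Mono (incl hle) := by
    have : ∀ X, Mono ((incl hle).app X) := fun X =>
      (ModuleCat.mono_iff_injective _).2 (Submodule.inclusion_injective (hle X))
    exact NatTrans.mono_of_mono_app _
  have : Epi π := by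
    have : ∀ X, Epi (π.app X) := fun X => (ModuleCat.epi_iff_surjective _).2 fun q => by
      obtain ⟨g, rfl⟩ := Submodule.mkQ_surjective _ q
      refine ⟨(⟨v ≫ g, S.comp_mem g hv⟩ : S.carrier X), hπ X ⟨v ≫ g, S.comp_mem g hv⟩ g ?_⟩
      simp
    exact NatTrans.epi_of_epi_app _
  refine IsStdFiltered.ext (ShortComplex.mk (incl hle) π w) ?_ m hm (Iso.refl _) h
  -- Exactness holds because the inclusion is a kernel of `π`: by `hzero`, a map killed by `π` takes
  -- its values in `S'`.
  suffices hk : Limits.IsLimit (Limits.KernelFork.ofι (incl hle) w) from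
    { exact := ShortComplex.exact_of_f_is_kernel (.mk (incl hle) π w) hk
      mono_f := ‹_›
      epi_g := ‹_› }
  refine Limits.KernelFork.IsLimit.ofι' _ _ fun {A} a ha => ⟨?_, ?_⟩
  · exact
      { app := fun X => ModuleCat.ofHom
          { toFun := fun x => ⟨((a.app X).hom x).1, (hzero X _).1
              (congrArg (fun t => (t.app X).hom x) ha)⟩
            map_add' := fun x y => by
              have := congrArg Subtype.val ((a.app X).hom.map_add x y)
              exact Subtype.ext this
            map_smul' := fun r x => by
              have := congrArg Subtype.val ((a.app X).hom.map_smul r x)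
              exact Subtype.ext this }
        naturality := fun X Y g => by
          ext x
          have := congrArg (fun t => (t.hom x).1) (a.naturality g)
          exact Subtype.ext this }
  · ext X x
    rfl

theorem isStdFiltered_of_eq_bot {lt : D → D → Prop} {p : D → Prop} {S : ProjSub k l}
    (h : ∀ X, S.carrier X = ⊥) : IsStdFiltered k lt p S.toFunctor := by
  refine IsStdFiltered.zero _ ((Limits.IsZero.iff_id_eq_zero _).2 ?_)
  ext X x
  exact Subtype.ext ((Submodule.mem_bot k).1 ((h X).le x.2))

end ProjSub

/-- Only the last short exact sequence has to be transported; the filtration of its first term is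
untouched. -/
theorem IsStdFiltered.of_iso {lt : D → D → Prop} {p : D → Prop} {M M' : D ⥤ ModuleCat.{v} k}
    (e : M ≅ M') (h : IsStdFiltered k lt p M) : IsStdFiltered k lt p M' := by
  cases h with
  | zero _ hM => exact .zero _ (hM.of_iso e.symm)
  | ext S hS m hm e' h =>
    refine .ext (ShortComplex.mk (S.f ≫ e.hom) (e.inv ≫ S.g) (by simp)) ?_ m hm e' h
    exact ShortComplex.shortExact_of_iso (S₁ := S)
      (ShortComplex.isoMk (Iso.refl _) e (Iso.refl _) (by simp) (by simp)) hS

/-- The kernel of `D(l, -) ⟶ Δ(l)` as a submodule. -/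
def notLeSub (k : Type w) [Field k] {D : Type u} [Category.{v} D] [Preadditive D]
    [Linear k D] (lt : D → D → Prop) (l : D) : ProjSub k l where
  carrier X := (notLeIdeal k lt l).carrier l X
  comp_mem g hf := (notLeIdeal k lt l).mem_comp g hf

/-- Replaces the abstract kernel by an explicit submodule, so that filtrations can be built from
subspaces of morphism spaces. -/
theorem isStdFiltered_kernel_stdProj {lt : D → D → Prop} {p : D → Prop} {l : D}
    (h : IsStdFiltered k lt p (notLeSub k lt l).toFunctor) :
    IsStdFiltered k lt p (Limits.kernel (stdProj k lt l)) := by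
  let ι : (notLeSub k lt l).toFunctor ⟶ (linearCoyoneda k D).obj (op l) :=
    { app := fun X => ModuleCat.ofHom ((notLeIdeal k lt l).carrier l X).subtype
      naturality := fun X Y g => by
        apply ModuleCat.hom_ext
        ext f
        rfl }
  have w : ι ≫ stdProj k lt l = 0 := by
    ext X f
    exact (Submodule.Quotient.mk_eq_zero _).2 f.2
  have : Mono ι := by
    have : ∀ X, Mono (ι.app X) := fun X =>
      (ModuleCat.mono_iff_injective _).2 (Submodule.subtype_injective _)
    exact NatTrans.mono_of_mono_app _
  have hk : Limits.IsLimit (Limits.KernelFork.ofι ι w) :=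
    Limits.KernelFork.IsLimit.ofι' _ _ fun {A} a ha => by
      have hmem : ∀ X (x : A.obj X), (a.app X).hom x ∈ (notLeIdeal k lt l).carrier l X :=
        fun X x => (Submodule.Quotient.mk_eq_zero _).1 (congrArg (fun t => (t.app X).hom x) ha)
      refine ⟨{ app := fun X => ModuleCat.ofHom ((a.app X).hom.codRestrict _ (hmem X))
                naturality := fun X Y g => ?_ }, ?_⟩
      · ext x
        exact Subtype.ext (congrArg (fun t => t.hom x) (a.naturality g))
      · ext X x
        rfl
  exact h.of_iso (hk.conePointUniqueUpToIso (Limits.limit.isLimit _))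

theorem comp_mem_notLeIdeal {lt : D → D → Prop} {l ν X Y : D} (hν : ¬ (ν = l ∨ lt ν l))
    (f : X ⟶ ν) (g : ν ⟶ Y) : f ≫ g ∈ (notLeIdeal k lt l).carrier X Y :=
  Submodule.subset_span ⟨ν, ν, f, 𝟙 ν, g, ⟨hν, rfl, rfl⟩, by simp⟩

theorem notLeIdeal_le {lt : D → D → Prop} {l X Y : D} {T : Submodule k (X ⟶ Y)}
    (h : ∀ ν, ¬ (ν = l ∨ lt ν l) → ∀ (f : X ⟶ ν) (g : ν ⟶ Y), f ≫ g ∈ T) :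
    (notLeIdeal k lt l).carrier X Y ≤ T := by
  refine Submodule.span_le.2 ?_
  rintro _ ⟨A, B, f, r, g, ⟨hν, rfl, rfl⟩, rfl⟩
  simpa using h A hν f g

end StandardFiltrations

/-! ## Morphisms of `ℭ` and of its trivial extension in terms of a filtered category -/

namespace IdealFiltration

variable {k : Type w} [Field k] {C : Type u} [Category.{v} C] [Preadditive C] [Linear k C]

/-- The filtration indexed by integers, constant in negative degrees. -/
abbrev zIdeal (F : IdealFiltration k C) (d : ℤ) (x y : C) : Submodule k (x ⟶ y) :=
  F.ideal d.toNat x y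

section

variable (F : IdealFiltration k C)

theorem zIdeal_anti {d e : ℤ} (h : d ≤ e) {x y : C} {a : x ⟶ y} (ha : a ∈ F.zIdeal e x y) :
    a ∈ F.zIdeal d x y :=
  F.anti (by omega) _ _ ha

theorem mem_zIdeal_of_nonpos {d : ℤ} (h : d ≤ 0) {x y : C} (a : x ⟶ y) :
    a ∈ F.zIdeal d x y := by
  have h0 : d.toNat = 0 := by omega
  rw [zIdeal, h0, F.zero]
  exact Submodule.mem_top

variable (N : ℕ)

/-- The object `x[i]` of `ℭ`. -/
abbrev cObj (x : C) (i : ℤ) : F.CCat N := ⟨⟨x, i⟩⟩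

/-- The morphism `x[i] ⟶ y[j]` of `ℭ` given by an element of `I_{j-i}`. -/
def cmk {x y : C} {i j : ℤ} (a : x ⟶ y) (ha : a ∈ F.zIdeal (j - i) x y) :
    F.cObj N x i ⟶ F.cObj N y j :=
  Submodule.Quotient.mk (p := (F.bIdeal N).carrier ⟨x, i⟩ ⟨y, j⟩)
    (⟨a, ha⟩ : F.bHom ⟨x, i⟩ ⟨y, j⟩)

variable {N} {x y z : C} {i j l : ℤ}

theorem exists_cmk (f : F.cObj N x i ⟶ F.cObj N y j) : ∃ a ha, f = F.cmk N a ha := by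
  obtain ⟨⟨a, ha⟩, rfl⟩ := Submodule.Quotient.mk_surjective _ f
  exact ⟨a, ha, rfl⟩

theorem cmk_eq_zero {a : x ⟶ y} {ha : a ∈ F.zIdeal (j - i) x y} :
    F.cmk N a ha = 0 ↔ a ∈ F.zIdeal (N - (i - j)) x y :=
  Submodule.Quotient.mk_eq_zero _

theorem cmk_comp {a : x ⟶ y} {ha : a ∈ F.zIdeal (j - i) x y} {b : y ⟶ z}
    {hb : b ∈ F.zIdeal (l - j) y z} :
    F.cmk N a ha ≫ F.cmk N b hb = F.cmk N (a ≫ b)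
      (F.anti (by omega) _ _ (F.mul _ _ ha hb)) := rfl

theorem cmk_sub {a b : x ⟶ y} {ha : a ∈ F.zIdeal (j - i) x y} {hb : b ∈ F.zIdeal (j - i) x y} :
    F.cmk N a ha - F.cmk N b hb = F.cmk N (a - b) (sub_mem ha hb) := rfl

theorem cmk_zero : F.cmk N (0 : x ⟶ y) (Submodule.zero_mem _) =
    (0 : F.cObj N x i ⟶ F.cObj N y j) := rfl

theorem cmk_eq_cmk {a b : x ⟶ y} {ha : a ∈ F.zIdeal (j - i) x y}
    {hb : b ∈ F.zIdeal (j - i) x y} :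
    F.cmk N a ha = F.cmk N b hb ↔ a - b ∈ F.zIdeal (N - (i - j)) x y := by
  rw [← sub_eq_zero, cmk_sub, cmk_eq_zero]

theorem cmk_id_comp {h : 𝟙 x ∈ F.zIdeal (j - i) x x} {b : x ⟶ y}
    {hb : b ∈ F.zIdeal (l - j) x y} (hb' : b ∈ F.zIdeal (l - i) x y) :
    F.cmk N (𝟙 x) h ≫ F.cmk N b hb = F.cmk N b hb' := by
  rw [cmk_comp, cmk_eq_cmk, Category.id_comp, sub_self]
  exact Submodule.zero_mem _

theorem cmk_comp_id {h : 𝟙 y ∈ F.zIdeal (l - j) y y} {b : x ⟶ y}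
    {hb : b ∈ F.zIdeal (j - i) x y} (hb' : b ∈ F.zIdeal (l - i) x y) :
    F.cmk N b hb ≫ F.cmk N (𝟙 y) h = F.cmk N b hb' := by
  rw [cmk_comp, cmk_eq_cmk, Category.comp_id, sub_self]
  exact Submodule.zero_mem _

end

section

variable (F : IdealFiltration k C) (N : ℕ)

/-- The trivial extension of `ℭ`. -/
abbrev DExt := TrivExt k (F.CCat N)

/-- The object `x[i]` of the trivial extension of `ℭ`. -/
abbrev dObj (x : C) (i : ℤ) : F.DExt N := ⟨F.cObj N x i⟩

variable {F N} {X Y Z : F.DExt N}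

/-- A morphism of the trivial extension from its two components. -/
abbrev dmk (f : X.obj ⟶ Y.obj) (φ : Module.Dual k (Y.obj ⟶ X.obj)) : X ⟶ Y := (f, φ)

theorem dComp_snd (f : X ⟶ Y) (g : Y ⟶ Z) (h : Z.obj ⟶ X.obj) :
    (f ≫ g).2 h = f.2 (g.1 ≫ h) + g.2 (h ≫ f.1) := rfl

theorem dHom_ext {f g : X ⟶ Y} (h1 : f.1 = g.1) (h2 : ∀ h, f.2 h = g.2 h) : f = g :=
  Prod.ext h1 (LinearMap.ext h2)

variable (F N)

/-- The morphism `x[i] ⟶ x[j]` given by the identity of `x`, for `j ≤ i`. -/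
def shift (x : C) {i j : ℤ} (h : j ≤ i) : F.dObj N x i ⟶ F.dObj N x j :=
  (F.cmk N (𝟙 x) (F.mem_zIdeal_of_nonpos (by omega) _), 0)

variable {F N}

theorem shift_comp_shift (x : C) {i j l : ℤ} (h : j ≤ i) (h' : l ≤ j) :
    F.shift N x h ≫ F.shift N x h' = F.shift N x (h'.trans h) :=
  dHom_ext (cmk_id_comp F _) fun _ => add_zero _

end

/-- The properties of the radical filtration of `Ã` that make `𝔇(Ã)` quasi-hereditary. -/
structure IsTildeLike (F : IdealFiltration k C) (N : ℕ) (new : C → Prop) : Prop where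
  finite_obj : Finite C
  finite_hom : ∀ x y : C, FiniteDimensional k (x ⟶ y)
  ideal_eq_bot : ∀ x y : C, F.ideal N x y = ⊥
  ideal_one_of_ne : ∀ {x y : C}, x ≠ y → F.ideal 1 x y = ⊤
  exists_scalar : ∀ {x : C} (f : x ⟶ x), ∃ c : k, f - c • 𝟙 x ∈ F.ideal 1 x x
  id_notMem : ∀ x : C, 𝟙 x ∉ F.ideal 1 x x
  ideal_to_old : ∀ {x : C}, ¬ new x → ∀ y, F.ideal (N - 1) y x = ⊥
  ideal_from_new : ∀ {x : C}, new x → ∀ y, F.ideal (N - 1) x y = ⊥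
  hom_new : ∀ {x y : C}, new x → new y → x ≠ y → ∀ f : x ⟶ y, f = 0

/-- The second order on the objects of the trivial extension of `ℭ`: `Y[j] < X[i]` if `i < j`, or
if `i = j`, `Y` is old and `X` is new. -/
def secondLT (F : IdealFiltration k C) (N : ℕ) (new : C → Prop) (Y X : F.DExt N) : Prop :=
  X.obj.obj.idx < Y.obj.obj.idx ∨
    (X.obj.obj.idx = Y.obj.obj.idx ∧ ¬ new Y.obj.obj.obj ∧ new X.obj.obj.obj)

theorem not_le_cases {F : IdealFiltration k C} {N : ℕ} {new : C → Prop} {x u : C} {i m : ℤ}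
    (h : ¬ (F.dObj N u m = F.dObj N x i ∨ F.secondLT N new (F.dObj N u m) (F.dObj N x i))) :
    m < i ∨ (m = i ∧ u ≠ x ∧ (new x → new u)) := by
  simp only [secondLT, not_or, not_and, not_lt] at h
  obtain ⟨h1, h2, h3⟩ := h
  rcases h2.lt_or_eq with h | h
  · exact .inl h
  · refine .inr ⟨h, ?_, fun hx => ?_⟩
    · rintro rfl
      exact h1 (by rw [h])
    · by_contra hu
      exact h3 h.symm hu hx

theorem not_le_of_lt {F : IdealFiltration k C} {N : ℕ} {new : C → Prop} {x u : C} {i m : ℤ}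
    (h : m < i) :
    ¬ (F.dObj N u m = F.dObj N x i ∨ F.secondLT N new (F.dObj N u m) (F.dObj N x i)) := by
  rintro (h' | h' | h')
  · have : m = i := congrArg (fun X : F.DExt N => X.obj.obj.idx) h'
    omega
  · exact absurd h' (by simpa using h.le)
  · have : i = m := h'.1
    omega

theorem not_le_of_new {F : IdealFiltration k C} {N : ℕ} {new : C → Prop} {x u : C} {i : ℤ}
    (hx : ¬ new x) (hu : new u) :
    ¬ (F.dObj N u i = F.dObj N x i ∨ F.secondLT N new (F.dObj N u i) (F.dObj N x i)) := by
  rintro (h' | h' | h')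
  · have : u = x := congrArg (fun X : F.DExt N => X.obj.obj.obj) h'
    exact hx (this ▸ hu)
  · exact lt_irrefl i h'
  · exact h'.2.1 hu

namespace IsTildeLike

variable {F : IdealFiltration k C} {N : ℕ} {new : C → Prop} (H : F.IsTildeLike N new)

include H

theorem eq_zero_of_mem {d : ℤ} (hd : N ≤ d) {x y : C} {a : x ⟶ y} (ha : a ∈ F.zIdeal d x y) :
    a = 0 := by
  have := F.zIdeal_anti hd ha
  rw [zIdeal, Int.toNat_natCast, H.ideal_eq_bot] at this
  exact (Submodule.mem_bot k).1 this

theorem one_le (x : C) : 1 ≤ N := by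
  by_contra h
  have h1 : 𝟙 x = 0 := H.eq_zero_of_mem (d := 0) (by omega) (F.mem_zIdeal_of_nonpos le_rfl _)
  exact H.id_notMem x (h1 ▸ Submodule.zero_mem _)

theorem mem_one_of_ne {x y : C} (h : x ≠ y) (a : x ⟶ y) : a ∈ F.zIdeal 1 x y := by
  rw [zIdeal, Int.toNat_one, H.ideal_one_of_ne h]
  exact Submodule.mem_top

theorem eq_zero_of_old {x y : C} (hx : ¬ new x) {a : y ⟶ x} (ha : a ∈ F.zIdeal (N - 1) y x) :
    a = 0 := by
  have h0 : ((N : ℤ) - 1).toNat = N - 1 := by omega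
  rw [zIdeal, h0, H.ideal_to_old hx] at ha
  exact (Submodule.mem_bot k).1 ha

theorem eq_zero_of_new {x y : C} (hx : new x) {a : x ⟶ y} (ha : a ∈ F.zIdeal (N - 1) x y) :
    a = 0 := by
  have h0 : ((N : ℤ) - 1).toNat = N - 1 := by omega
  rw [zIdeal, h0, H.ideal_from_new hx] at ha
  exact (Submodule.mem_bot k).1 ha

end IsTildeLike

end IdealFiltration

theorem finrank_stdModule_eq_one {k : Type w} [Field k] {D : Type u} [Category.{v} D]
    [Preadditive D] [Linear k D] {lt : D → D → Prop} {l : D}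
    (h1 : 𝟙 l ∉ (notLeIdeal k lt l).carrier l l)
    (h2 : ∀ f : l ⟶ l, ∃ c : k, f - c • 𝟙 l ∈ (notLeIdeal k lt l).carrier l l) :
    Module.finrank k ((stdModule k lt l).obj l) = 1 := by
  change Module.finrank k ((l ⟶ l) ⧸ (notLeIdeal k lt l).carrier l l) = 1
  refine (finrank_eq_one_iff_of_nonzero' (Submodule.Quotient.mk (𝟙 l)) ?_).2 fun q => ?_
  · exact fun h => h1 ((Submodule.Quotient.mk_eq_zero _).1 h)
  · obtain ⟨f, rfl⟩ := Submodule.Quotient.mk_surjective _ q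
    obtain ⟨c, hc⟩ := h2 f
    exact ⟨c, ((Submodule.Quotient.eq _).2 hc).symm⟩

/-! ## Left standard modules of the trivial extension -/

namespace IdealFiltration

variable {k : Type w} [Field k] {C : Type u} [Category.{v} C] [Preadditive C] [Linear k C]
  {F : IdealFiltration k C} {N : ℕ} {new : C → Prop}

/-- Precomposition with a shift keeps the underlying morphism of Ã and pulls the form back along
postcomposition with the shift. A form is such a pullback iff it vanishes on what the shift kills,
here the classes of I_{N-(l-j)-1}. -/
theorem exists_eq_shift_comp {x y : C} {j j' l : ℤ} (hj : j' + 1 = j) {a : x ⟶ y}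
    (ha : a ∈ F.zIdeal (l - j) x y) (ha' : a ∈ F.zIdeal (l - j + 1) x y)
    (ψ : Module.Dual k (F.cObj N y l ⟶ F.cObj N x j))
    (hψ : ∀ (b : y ⟶ x) (hb : b ∈ F.zIdeal (j - l) y x), b ∈ F.zIdeal (N - (l - j) - 1) y x →
      ψ (F.cmk N b hb) = 0) :
    ∃ g' : F.dObj N x j' ⟶ F.dObj N y l,
      (dmk (F.cmk N a ha) ψ : F.dObj N x j ⟶ F.dObj N y l) =
        F.shift N x (by omega : j' ≤ j) ≫ g' := by
  let T := Linear.rightComp k (F.cObj N y l) (F.shift N x (by omega : j' ≤ j)).1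
  have hψT : ψ ∈ (LinearMap.ker T).dualAnnihilator := by
    rw [Submodule.mem_dualAnnihilator]
    intro f hf
    obtain ⟨b, hb, rfl⟩ := F.exists_cmk f
    refine hψ b hb ?_
    have h0 : F.cmk N b hb ≫ (F.shift N x (by omega : j' ≤ j)).1 = 0 := hf
    unfold shift at h0
    rw [cmk_comp_id F (F.zIdeal_anti (by omega) hb), cmk_eq_zero] at h0
    exact F.zIdeal_anti (by omega) h0
  rw [← LinearMap.range_dualMap_eq_dualAnnihilator_ker] at hψT
  obtain ⟨ψ', rfl⟩ := hψT
  refine ⟨dmk (F.cmk N a (F.zIdeal_anti (by omega) ha')) ψ', dHom_ext ?_ fun h => ?_⟩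
  · exact (cmk_id_comp F ha).symm
  · exact (zero_add _).symm

/-- Both conditions of `exists_eq_shift_comp` follow from i - j < N: the first component lies in
I_{N-(i-l)} ⊆ I_{l-j+1}, and elements of I_{N-(l-j)-1} already define maps y[l] ⟶ x[i], on which the
pulled-back form is zero. -/
theorem exists_eq_shift_comp_of_shift_comp_eq_zero {x : C} {X : F.DExt N} {i j j' : ℤ}
    (hj : j' + 1 = j) (hji : j ≤ i) (hN : i < j + N) (g : F.dObj N x j ⟶ X)
    (hg : F.shift N x hji ≫ g = 0) :
    ∃ g', g = F.shift N x (by omega : j' ≤ j) ≫ g' := by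
  obtain ⟨⟨⟨y, l⟩⟩⟩ := X
  obtain ⟨f, ψ⟩ := g
  obtain ⟨a, ha, rfl⟩ := F.exists_cmk f
  refine exists_eq_shift_comp hj ha ?_ ψ fun b hb hb' => ?_
  · have h0 : F.cmk N (𝟙 x) _ ≫ F.cmk N a ha = 0 := congrArg Prod.fst hg
    rw [cmk_id_comp F (F.zIdeal_anti (by omega) ha), cmk_eq_zero] at h0
    exact F.zIdeal_anti (by omega) h0
  · have h0 := LinearMap.congr_fun (congrArg Prod.snd hg)
      (F.cmk N b (F.zIdeal_anti (by omega) hb'))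
    rw [dComp_snd] at h0
    have h1 : F.cmk N b (F.zIdeal_anti (by omega) hb') ≫ (F.shift N x hji).1 = F.cmk N b hb :=
      cmk_comp_id F _
    rw [h1] at h0
    exact (zero_add _).symm.trans h0

namespace IsTildeLike

variable (H : F.IsTildeLike N new)

include H

/-- A composite through u[m] not ≤ x[i] gains a degree: either m < i, or m = i and u ≠ x, so that x
⟶ u is radical. For the term φ(b ≫ c) of the dual component the case m = i gains nothing. There b ≫
c lies in I_{N-1}(u, x), which is zero for x old, while for x new u is another new vertex and Ã(u,
x) = 0. -/
theorem mem_notLeIdeal_left {x : C} {X : F.DExt N} {i i' : ℤ} (hi : i' + 1 = i)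
    (g : F.dObj N x i ⟶ X) :
    g ∈ (notLeIdeal k (F.secondLT N new) (F.dObj N x i)).carrier (F.dObj N x i) X ↔
      ∃ g', g = F.shift N x (by omega : i' ≤ i) ≫ g' := by
  constructor
  · intro hg
    suffices h : (notLeIdeal k (F.secondLT N new) (F.dObj N x i)).carrier (F.dObj N x i) X ≤
        LinearMap.range (Linear.leftComp k X (F.shift N x (by omega : i' ≤ i))) by
      obtain ⟨g', hg'⟩ := h hg
      exact ⟨g', hg'.symm⟩
    refine notLeIdeal_le fun ν hν f g => ?_
    obtain ⟨⟨⟨u, m⟩⟩⟩ := ν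
    obtain ⟨⟨⟨y, l⟩⟩⟩ := X
    obtain ⟨f, φ⟩ := f
    obtain ⟨g, ψ⟩ := g
    obtain ⟨a, ha, rfl⟩ := F.exists_cmk f
    obtain ⟨b, hb, rfl⟩ := F.exists_cmk g
    replace hν := not_le_cases hν
    have key := exists_eq_shift_comp (N := N) (F := F) hi (a := a ≫ b)
      (F.anti (by omega) _ _ (F.mul _ _ ha hb)) ?_
      ((dmk (F.cmk N a ha) φ : F.dObj N x i ⟶ F.dObj N u m) ≫
        (dmk (F.cmk N b hb) ψ : F.dObj N u m ⟶ F.dObj N y l)).2 ?_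
    · obtain ⟨g', hg'⟩ := key
      exact ⟨g', hg'.symm⟩
    · rcases hν with h | ⟨rfl, hu, -⟩
      · exact F.anti (by omega) _ _ (F.mul _ _ ha hb)
      · exact F.anti (by omega) _ _ (F.mul _ _ (H.mem_one_of_ne hu.symm a) hb)
    · intro c hc hc'
      rw [dComp_snd]
      dsimp only
      -- For l < i the degree N - (l - i) - 1 is at least N, so c = 0. For l ≥ i the exponent l - m
      -- is non-negative, so adding degrees loses nothing to the truncation at 0.
      rcases lt_or_ge l i with hl | hl
      · obtain rfl := H.eq_zero_of_mem (by omega) hc'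
        rw [cmk_zero, Limits.comp_zero, Limits.zero_comp, map_zero, map_zero, add_zero]
      · have h1 : b ≫ c = 0 := by
          rcases hν with h | ⟨rfl, hu, hxu⟩
          · exact H.eq_zero_of_mem le_rfl (F.anti (by omega) _ _ (F.mul _ _ hb hc'))
          · by_cases hx : new x
            · exact H.hom_new (hxu hx) hx hu _
            · exact H.eq_zero_of_old hx (F.anti (by omega) _ _ (F.mul _ _ hb hc'))
        have h2 : c ≫ a ∈ F.zIdeal (N - (l - m)) y u := by
          rcases hν with h | ⟨rfl, hu, hxu⟩
          · exact F.anti (by omega) _ _ (F.mul _ _ hc' ha)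
          · exact F.anti (by omega) _ _ (F.mul _ _ hc' (H.mem_one_of_ne hu.symm a))
        have e1 : F.cmk N b hb ≫ F.cmk N c hc = 0 := by
          rw [cmk_comp, cmk_eq_zero, h1]
          exact Submodule.zero_mem _
        have e2 : F.cmk N c hc ≫ F.cmk N a ha = 0 := by
          rw [cmk_comp, cmk_eq_zero]
          exact h2
        rw [e1, e2, map_zero, map_zero, add_zero]
  · rintro ⟨g', rfl⟩
    exact comp_mem_notLeIdeal (not_le_of_lt (by omega)) _ _

end IsTildeLike

/-- The submodule of `D(x[i], -)` generated by the canonical morphism `x[i] ⟶ x[j]`. -/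
def shiftSub (F : IdealFiltration k C) (N : ℕ) (x : C) {i j : ℤ} (h : j ≤ i) :
    ProjSub k (F.dObj N x i) where
  carrier X := LinearMap.range (Linear.leftComp k X (F.shift N x h))
  comp_mem := by
    rintro X Y _ g ⟨f, rfl⟩
    exact ⟨f ≫ g, by simp⟩

namespace IsTildeLike

variable (H : F.IsTildeLike N new)

include H

/-- At j = i - N the shift is zero, since its denominator is I_0. Each increase of j to j + 1 puts a
copy of Δ(x[j+1]) on top. -/
theorem isStdFiltered_shiftSub (x : C) (i j : ℤ) (hj : i - N ≤ j) (hji : j < i) :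
    IsStdFiltered k (F.secondLT N new) (fun m => F.secondLT N new (F.dObj N x i) m)
      (F.shiftSub N x hji.le).toFunctor := by
  induction j, hj using Int.leInduction with
  | base =>
    refine ProjSub.isStdFiltered_of_eq_bot fun X => ?_
    have h0 : F.shift N x hji.le = 0 := by
      refine Prod.ext ?_ rfl
      exact (cmk_eq_zero F).2 (F.mem_zIdeal_of_nonpos (by omega) _)
    refine LinearMap.range_eq_bot.2 (LinearMap.ext fun g => ?_)
    change F.shift N x hji.le ≫ g = 0
    rw [h0, Limits.zero_comp]
  | succ j hj ih =>
    have hj' : j < i := by omega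
    have hle : j ≤ j + 1 := by omega
    have hcomp := shift_comp_shift (F := F) (N := N) x hji.le hle
    refine ProjSub.isStdFiltered_of_generator (S' := F.shiftSub N x hj'.le)
      ?_ (m := F.dObj N x (j + 1)) (.inl hji) (F.shift N x hji.le) ⟨𝟙 _, by simp⟩ ?_ ?_
      (ih hj')
    · rintro X _ ⟨g, rfl⟩
      refine ⟨F.shift N x hle ≫ g, ?_⟩
      change _ ≫ _ ≫ g = _ ≫ g
      rw [← Category.assoc, hcomp]
    · rintro X _ ⟨g, rfl⟩
      refine ⟨g, ?_⟩
      rw [Linear.leftComp_apply, sub_self]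
      exact Submodule.zero_mem _
    · intro X g
      rw [H.mem_notLeIdeal_left rfl]
      constructor
      · rintro ⟨g', hg'⟩
        -- The difference of `g` and the map induced by `g'` is killed by x[i] ⟶ x[j+1], hence
        -- factors through x[j+1] ⟶ x[j] like the latter.
        replace hg' : F.shift N x hj'.le ≫ g' = F.shift N x hji.le ≫ g := hg'
        rw [← hcomp, Category.assoc, eq_comm, ← sub_eq_zero, ← Preadditive.comp_sub] at hg'
        obtain ⟨g'', hg''⟩ :=
          exists_eq_shift_comp_of_shift_comp_eq_zero rfl hji.le (by omega) _ hg'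
        refine ⟨g' + g'', ?_⟩
        rw [Preadditive.comp_add, ← hg'', add_sub_cancel]
      · rintro ⟨g', rfl⟩
        refine ⟨g', ?_⟩
        rw [Linear.leftComp_apply, ← Category.assoc, hcomp]

theorem hasStandardFiltrationsLeft : HasStandardFiltrationsLeft k (F.secondLT N new) := by
  intro X
  obtain ⟨⟨⟨x, i⟩⟩⟩ := X
  have hi : i - 1 + 1 = i := by omega
  have hN := H.one_le x
  constructor
  · refine finrank_stdModule_eq_one (fun h => ?_) fun f => ?_
    · obtain ⟨⟨g, ψ⟩, hg⟩ := (H.mem_notLeIdeal_left hi _).1 h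
      obtain ⟨a, ha, rfl⟩ := F.exists_cmk g
      have h1 : F.cmk N (i := i) (j := i) (𝟙 x) (F.mem_zIdeal_of_nonpos (by omega) _) =
        F.cmk N (𝟙 x) _ ≫ F.cmk N a ha := congrArg Prod.fst hg
      rw [cmk_id_comp F (F.mem_zIdeal_of_nonpos (by omega) _), cmk_eq_cmk] at h1
      have h2 := sub_eq_zero.1 (H.eq_zero_of_mem (by omega) h1)
      exact H.id_notMem x (h2 ▸ F.zIdeal_anti (d := 1) (by omega) ha)
    · obtain ⟨f, φ⟩ := f
      obtain ⟨a, ha, rfl⟩ := F.exists_cmk f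
      obtain ⟨c, hc⟩ := H.exists_scalar a
      refine ⟨c, (H.mem_notLeIdeal_left hi _).2 ?_⟩
      -- `c • 0` is the dual component of `c • 𝟙`, kept in this shape so that the pair matches
      -- definitionally.
      refine exists_eq_shift_comp hi (a := a - c • 𝟙 x) (F.mem_zIdeal_of_nonpos (by omega) _) ?_
        (φ - c • 0) fun b hb hb' => ?_
      · exact F.anti (by omega) _ _ hc
      -- The form must vanish on I_{N-1}(x, x), which is zero whether x is old or new.
      · have : b = 0 := by
          by_cases hx : new x
          · exact H.eq_zero_of_new hx (F.zIdeal_anti (by omega) hb')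
          · exact H.eq_zero_of_old hx (F.zIdeal_anti (by omega) hb')
        subst this
        rw [cmk_zero, map_zero]
  · refine isStdFiltered_kernel_stdProj ?_
    convert H.isStdFiltered_shiftSub x i (i - 1) (by omega) (by omega)
    ext X g
    refine (H.mem_notLeIdeal_left hi g).trans ?_
    exact exists_congr fun g' => eq_comm

end IsTildeLike

end IdealFiltration

/-! ### One-dimensional refinements and passage to the opposite category -/

/-- Induction along a chain of families of subspaces that grow by one dimension at a time. -/
theorem Submodule.family_induction {ι : Type*} [Finite ι] {k : Type*} [Field k] {V : ι → Type*}
    [∀ i, AddCommGroup (V i)] [∀ i, Module k (V i)] [∀ i, FiniteDimensional k (V i)]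
    (Q : (∀ i, Submodule k (V i)) → Prop) {A B : ∀ i, Submodule k (V i)} (hAB : A ≤ B) (hA : Q A)
    (step : ∀ (W W' : ∀ i, Submodule k (V i)) (u : ι) (v : V u), A ≤ W → W ≤ B → v ∈ B u →
      v ∉ W u → W' u = W u ⊔ Submodule.span k {v} → (∀ i, i ≠ u → W' i = W i) → Q W → Q W') :
    Q B := by
  classical
  -- Families embed strictly monotonically into the subspaces of the finite-dimensional product, so
  -- they satisfy the ascending chain condition.
  have hmono : StrictMono fun W : ∀ i, Submodule k (V i) => Submodule.pi Set.univ W := by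
    refine Monotone.strictMono_of_injective
      (fun W W' h f hf i hi => h i (hf i hi)) fun W W' h => ?_
    have key : ∀ W W' : ∀ i, Submodule k (V i),
        Submodule.pi Set.univ W = Submodule.pi Set.univ W' → W ≤ W' := by
      intro W W' h i x hx
      have : Pi.single i x ∈ Submodule.pi Set.univ W := by
        intro j _
        by_cases hj : j = i
        · subst hj
          simpa using hx
        · simp [hj]
      rw [h] at this
      simpa using this i (Set.mem_univ i)
    exact le_antisymm (key W W' h) (key W' W h.symm)
  have := hmono.wellFoundedGT
  -- A maximal family with `Q` is `B`: otherwise `step` enlarges it by a vector of `B`.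
  obtain ⟨W, ⟨hAW, hWB, hW⟩, hmax⟩ :=
    exists_maximal_of_wellFoundedGT (fun W => A ≤ W ∧ W ≤ B ∧ Q W) ⟨A, le_rfl, hAB, hA⟩
  suffices h : B ≤ W by rwa [le_antisymm h hWB]
  intro u v hv
  by_contra hvW
  let W' := Function.update W u (W u ⊔ Submodule.span k {v})
  have hu : W' u = W u ⊔ Submodule.span k {v} := Function.update_self ..
  have hne : ∀ i, i ≠ u → W' i = W i := fun i hi => Function.update_of_ne hi ..
  have hWW' : W ≤ W' := fun i => by
    by_cases hi : i = u
    · subst hi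
      exact le_sup_left.trans hu.ge
    · exact (hne i hi).ge
  have hW'B : W' ≤ B := fun i => by
    by_cases hi : i = u
    · subst hi
      rw [hu]
      exact sup_le (hWB i) (by simpa using hv)
    · exact (hne i hi).le.trans (hWB i)
  have := hmax ⟨hAW.trans hWW', hW'B, step W W' u v hAW hWB hv hvW hu hne hW⟩ hWW'
  exact hvW (this u (hu.ge (Submodule.mem_sup_right (Submodule.mem_span_singleton_self v))))

/-- Taking a morphism of the opposite category to the corresponding morphism. -/
def unopLin (k : Type w) [Field k] {D : Type u} [Category.{v} D] [Preadditive D] [Linear k D]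
    (X Y : Dᵒᵖ) : (X ⟶ Y) →ₗ[k] (Y.unop ⟶ X.unop) where
  toFun := Quiver.Hom.unop
  map_add' _ _ := rfl
  map_smul' _ _ := rfl

/-- A submodule of `D(-, l)`, as a submodule of a projective left module over `Dᵒᵖ`. -/
def ProjSub.ofRight {k : Type w} [Field k] {D : Type u} [Category.{v} D] [Preadditive D]
    [Linear k D] {l : D} (S : ∀ Y : D, Submodule k (Y ⟶ l))
    (hS : ∀ {Y Z : D} (g : Z ⟶ Y) {f : Y ⟶ l}, f ∈ S Y → g ≫ f ∈ S Z) : ProjSub k (op l) where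
  carrier X := (S X.unop).comap (unopLin k (op l) X)
  comp_mem g hf := hS g.unop hf

/-! ### Filtered right modules as layers of D(-, x[i]) -/

namespace IdealFiltration

variable {k : Type w} [Field k] {C : Type u} [Category.{v} C] [Preadditive C] [Linear k C]

/-- A layer of the projective right module `D(-, x[i])`: a submodule `base`, together with
submodules modulo `base` that are isomorphic to `y[j] ↦ M_{i-j}(y) / M_{N-(j-i)}(y)` for a filtered
right module `M` over the filtered category. -/
structure RightLayer (F : IdealFiltration k C) (N : ℕ) (x : C) (i : ℤ) where
  V : C → Type t
  [addCommGroup : ∀ y, AddCommGroup (V y)]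
  [module : ∀ y, Module k (V y)]
  M : ℤ → ∀ y, Submodule k (V y)
  anti : ∀ {s t : ℤ}, s ≤ t → ∀ y, M t y ≤ M s y
  act : ∀ {y y' : C}, (y' ⟶ y) →ₗ[k] V y →ₗ[k] V y'
  act_id : ∀ {y : C} (m : V y), act (𝟙 y) m = m
  act_mem : ∀ {y y' : C} {a : ℕ} {s : ℤ} {b : y' ⟶ y} {m : V y}, b ∈ F.ideal a y' y → m ∈ M s y →
    act b m ∈ M (a + s) y'
  base : ∀ Y : F.DExt N, Submodule k (Y ⟶ F.dObj N x i)
  base_comp : ∀ {Y Z : F.DExt N} (g : Z ⟶ Y) {f : Y ⟶ F.dObj N x i}, f ∈ base Y → g ≫ f ∈ base Z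
  T : ∀ (y : C) (j : ℤ), M (i - j) y →ₗ[k] (F.dObj N y j ⟶ F.dObj N x i)
  T_comp : ∀ {y y' : C} {j j' : ℤ} (b : y' ⟶ y) (hb : b ∈ F.zIdeal (j - j') y' y)
    (ψ : Module.Dual k (F.cObj N y j ⟶ F.cObj N y' j')) (m : V y) (hm : m ∈ M (i - j) y)
    (hbm : act b m ∈ M (i - j') y'),
    (dmk (F.cmk N b hb) ψ : F.dObj N y' j' ⟶ F.dObj N y j) ≫ T y j ⟨m, hm⟩ -
      T y' j' ⟨act b m, hbm⟩ ∈ base (F.dObj N y' j')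
  T_mem : ∀ {y : C} {j : ℤ} (m : M (i - j) y),
    T y j m ∈ base (F.dObj N y j) ↔ m.1 ∈ M (N - (j - i)) y

namespace RightLayer

attribute [instance] addCommGroup module

variable {F : IdealFiltration k C} {N : ℕ} {new : C → Prop} {x : C} {i : ℤ}
  (L : RightLayer F N x i)

/-- The submodule of `D(-, x[i])` given by a family of subspaces of the module of a layer. -/
def carrier (W : ∀ y, Submodule k (L.V y)) (Y : F.DExt N) : Submodule k (Y ⟶ F.dObj N x i) where
  carrier := {f | ∃ m : L.M (i - Y.obj.obj.idx) Y.obj.obj.obj, m.1 ∈ W Y.obj.obj.obj ∧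
    f - L.T Y.obj.obj.obj Y.obj.obj.idx m ∈ L.base Y}
  add_mem' := by
    rintro f f' ⟨m, hm, h⟩ ⟨m', hm', h'⟩
    refine ⟨m + m', add_mem hm hm', ?_⟩
    rw [map_add, add_sub_add_comm]
    exact add_mem h h'
  zero_mem' := ⟨0, Submodule.zero_mem _, by
    rw [map_zero, sub_zero]
    exact Submodule.zero_mem _⟩
  smul_mem' := by
    rintro r f ⟨m, hm, h⟩
    refine ⟨r • m, Submodule.smul_mem _ r hm, ?_⟩
    rw [map_smul, ← smul_sub]
    exact Submodule.smul_mem _ r h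

theorem act_mem_M {y y' : C} {j j' : ℤ} {b : y' ⟶ y} (hb : b ∈ F.zIdeal (j - j') y' y) {m : L.V y}
    (hm : m ∈ L.M (i - j) y) : L.act b m ∈ L.M (i - j') y' :=
  L.anti (by omega) _ (L.act_mem hb hm)

theorem carrier_comp {W : ∀ y, Submodule k (L.V y)}
    (hW : ∀ {y y' : C} (b : y' ⟶ y) {m : L.V y}, m ∈ W y → L.act b m ∈ W y') {Y Z : F.DExt N}
    (g : Z ⟶ Y) {f : Y ⟶ F.dObj N x i} (hf : f ∈ L.carrier W Y) : g ≫ f ∈ L.carrier W Z := by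
  obtain ⟨m, hm, h⟩ := hf
  obtain ⟨⟨⟨y, j⟩⟩⟩ := Y
  obtain ⟨⟨⟨y', j'⟩⟩⟩ := Z
  obtain ⟨g, ψ⟩ := g
  obtain ⟨b, hb, rfl⟩ := F.exists_cmk g
  refine ⟨⟨L.act b m, L.act_mem_M hb m.2⟩, hW b hm, ?_⟩
  have h1 := L.T_comp b hb ψ m.1 m.2 (L.act_mem_M hb m.2)
  have h2 := L.base_comp
    (dmk (F.cmk N b hb) ψ : F.dObj N y' j' ⟶ F.dObj N y j) h
  rw [Preadditive.comp_sub] at h2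
  have := add_mem h2 h1
  rwa [sub_add_sub_cancel] at this

/-- The submodule of `D(-, x[i])` given by a stable family of subspaces of the module of a layer. -/
def sub (W : ∀ y, Submodule k (L.V y))
    (hW : ∀ {y y' : C} (b : y' ⟶ y) {m : L.V y}, m ∈ W y → L.act b m ∈ W y') :
    ProjSub k (op (F.dObj N x i)) :=
  ProjSub.ofRight (L.carrier W) (L.carrier_comp hW)

end RightLayer

/-! ## The layers of `D(-, x[i])` coming from `ℭ` and from its dual -/

section Layers

variable (F : IdealFiltration k C) (N : ℕ) (x : C) (i : ℤ)

/-- The projection of morphisms of the trivial extension to those of `ℭ`. -/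
def fstLin {N : ℕ} (X Y : F.DExt N) : (X ⟶ Y) →ₗ[k] (X.obj ⟶ Y.obj) := LinearMap.fst k _ _

/-- The linear form on `ℭ(x[i], y[j])` induced by a linear form on `I_0(x, y)` that vanishes on the
denominator. -/
def dualDesc (y : C) (j : ℤ) :
    ((F.zIdeal (N - (i - j)) x y).dualAnnihilator : Submodule k (Module.Dual k (x ⟶ y))) →ₗ[k]
      Module.Dual k (F.cObj N x i ⟶ F.cObj N y j) where
  toFun Ψ := ((F.bIdeal N).carrier ⟨x, i⟩ ⟨y, j⟩).liftQ
    (Ψ.1 ∘ₗ (F.bHom (⟨x, i⟩ : F.BObj) ⟨y, j⟩).subtype)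
    fun a ha => (Submodule.mem_dualAnnihilator _).1 Ψ.2 a.1 ha
  map_add' Ψ Ψ' := by
    apply Submodule.linearMap_qext
    rfl
  map_smul' r Ψ := by
    apply Submodule.linearMap_qext
    rfl

theorem dualDesc_cmk {y : C} {j : ℤ}
    (Ψ : (F.zIdeal (N - (i - j)) x y).dualAnnihilator) (b : x ⟶ y)
    (hb : b ∈ F.zIdeal (j - i) x y) : F.dualDesc N x i y j Ψ (F.cmk N b hb) = Ψ.1 b := rfl

/-- A form on the subquotient is a form on I_{j-i} killing the denominator; over a field it extends
to all of Ã(x, y). -/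
theorem exists_dualDesc {y : C} {j : ℤ} (ψ : Module.Dual k (F.cObj N x i ⟶ F.cObj N y j)) :
    ∃ Ψ, F.dualDesc N x i y j Ψ = ψ := by
  obtain ⟨Ψ, hΨ⟩ := LinearMap.exists_extend (p := F.bHom (⟨x, i⟩ : F.BObj) ⟨y, j⟩)
    (ψ ∘ₗ ((F.bIdeal N).carrier ⟨x, i⟩ ⟨y, j⟩).mkQ)
  have h (b : x ⟶ y) (hb : b ∈ F.zIdeal (j - i) x y) : Ψ b = ψ (F.cmk N b hb) :=
    LinearMap.congr_fun hΨ ⟨b, hb⟩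
  refine ⟨⟨Ψ, (Submodule.mem_dualAnnihilator _).2 fun b hb => ?_⟩, LinearMap.ext fun f => ?_⟩
  · rw [h b (F.zIdeal_anti (by omega) hb), (cmk_eq_zero F).2 hb, map_zero]
  · obtain ⟨b, hb, rfl⟩ := F.exists_cmk f
    rw [dualDesc_cmk, h b hb]

/-- The layer given by the dual of `ℭ`. -/
def dualLayer : RightLayer F N x i where
  V y := Module.Dual k (x ⟶ y)
  -- The reflected index N - s makes the filtration decreasing, and makes M_{i-j} the forms that
  -- kill the denominator of ℭ(x[i], y[j]).
  M s y := (F.zIdeal (N - s) x y).dualAnnihilator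
  anti h y := Submodule.dualAnnihilator_anti fun _ ha => F.zIdeal_anti (by omega) ha
  act {y y'} := LinearMap.mk₂ k (fun b Ψ => Ψ ∘ₗ Linear.rightComp k x b)
    (fun b b' Ψ => by ext; simp) (fun r b Ψ => by ext; simp)
    (fun b Ψ Ψ' => by ext; simp) (fun r b Ψ => by ext; simp)
  act_id Ψ := by
    ext
    simp
  act_mem {y y' a s b Ψ} hb hΨ := by
    rw [Submodule.mem_dualAnnihilator] at hΨ ⊢
    intro h hh
    exact hΨ _ (F.anti (by omega) _ _ (F.mul _ _ hh hb))
  base Y := ⊥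
  base_comp {Y Z} g f hf := by
    rw [(Submodule.mem_bot k).1 hf, Limits.comp_zero]
    exact Submodule.zero_mem _
  T y j := LinearMap.inr k (F.cObj N y j ⟶ F.cObj N x i) _ ∘ₗ F.dualDesc N x i y j
  T_comp {y y' j j'} b hb ψ Ψ hΨ hbΨ := by
    refine (Submodule.mem_bot k).2 (sub_eq_zero.2 (dHom_ext Limits.comp_zero fun h => ?_))
    obtain ⟨c, hc, rfl⟩ := F.exists_cmk h
    change ψ (0 ≫ F.cmk N c hc) + F.dualDesc N x i y j ⟨Ψ, hΨ⟩ (F.cmk N c hc ≫ F.cmk N b hb) =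
      F.dualDesc N x i y' j' ⟨_, hbΨ⟩ (F.cmk N c hc)
    rw [Limits.zero_comp, map_zero, zero_add, cmk_comp, dualDesc_cmk, dualDesc_cmk]
    rfl
  T_mem {y j} Ψ := by
    -- Reflecting twice returns j - i: a form is zero on ℭ(x[i], y[j]) iff it kills the numerator
    -- I_{j-i}.
    have h0 : ((N : ℤ) - (N - (j - i))).toNat = (j - i).toNat := by omega
    change _ ↔ Ψ.1 ∈ (F.ideal ((N : ℤ) - (N - (j - i))).toNat x y).dualAnnihilator
    rw [Submodule.mem_bot, h0, Submodule.mem_dualAnnihilator]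
    constructor
    · intro h b hb
      exact LinearMap.congr_fun (congrArg Prod.snd h) (F.cmk N b hb)
    · intro h
      refine dHom_ext rfl fun f => ?_
      obtain ⟨b, hb, rfl⟩ := F.exists_cmk f
      exact h b hb

end Layers

end IdealFiltration

/-! ### Right standard modules and the addition of one vector to a layer -/

namespace IdealFiltration

variable {k : Type w} [Field k] {C : Type u} [Category.{v} C] [Preadditive C] [Linear k C]

/-- The layer given by `ℭ`. -/
def homLayer (F : IdealFiltration k C) (N : ℕ) (x : C) (i : ℤ) : RightLayer F N x i where
  V y := y ⟶ x
  M s y := F.zIdeal s y x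
  anti h y _ ha := F.zIdeal_anti h ha
  act {y y'} := Linear.comp y' y x
  act_id m := Category.id_comp m
  act_mem {y y' a s b m} hb hm := F.anti (by omega) _ _ (F.mul _ _ hb hm)
  base Y := LinearMap.ker (F.fstLin Y _)
  base_comp {Y Z} g f hf := by
    have h : f.1 = 0 := hf
    change g.1 ≫ f.1 = 0
    rw [h, Limits.comp_zero]
  T y j := LinearMap.inl k _ _ ∘ₗ ((F.bIdeal N).carrier ⟨y, j⟩ ⟨x, i⟩).mkQ
  T_comp {y y' j j'} b hb ψ m hm hbm := sub_self (F.cmk N (b ≫ m) hbm)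
  T_mem {y j} m := cmk_eq_zero F (ha := m.2)

variable {F : IdealFiltration k C} {N : ℕ} {new : C → Prop}

theorem mem_homLayer_carrier {x y : C} {i j : ℤ} {W : ∀ y, Submodule k (y ⟶ x)}
    {f : F.dObj N y j ⟶ F.dObj N x i} :
    f ∈ (F.homLayer N x i).carrier W (F.dObj N y j) ↔
      ∃ a ha, a ∈ W y ∧ f.1 = F.cmk N a ha := by
  constructor
  · rintro ⟨⟨a, ha⟩, haW, h⟩
    exact ⟨a, ha, haW, sub_eq_zero.1 h⟩
  · rintro ⟨a, ha, haW, h⟩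
    exact ⟨⟨a, ha⟩, haW, sub_eq_zero.2 h⟩

/-- Postcomposition with y[j] ⟶ y[l] on ℭ(x[i], y[j]) has its kernel represented by I_{N-(i-l)}(x,
y). If this is zero, every form is a pullback along it. -/
theorem exists_dual_eq_shift_comp {x y : C} {i j l : ℤ} (hl : l ≤ j)
    (h0 : ∀ b ∈ F.zIdeal (N - (i - l)) x y, b = 0)
    (φ : Module.Dual k (F.cObj N x i ⟶ F.cObj N y j)) :
    ∃ g : F.dObj N y l ⟶ F.dObj N x i,
      (dmk 0 φ : F.dObj N y j ⟶ F.dObj N x i) = F.shift N y hl ≫ g := by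
  let T := Linear.rightComp k (F.cObj N x i) (F.shift N y hl).1
  have hφ : φ ∈ (LinearMap.ker T).dualAnnihilator := by
    rw [Submodule.mem_dualAnnihilator]
    intro f hf
    obtain ⟨b, hb, rfl⟩ := F.exists_cmk f
    have h1 : F.cmk N b hb ≫ (F.shift N y hl).1 = 0 := hf
    unfold shift at h1
    rw [cmk_comp_id F (F.zIdeal_anti (by omega) hb), cmk_eq_zero] at h1
    obtain rfl := h0 b h1
    rw [cmk_zero, map_zero]
  rw [← LinearMap.range_dualMap_eq_dualAnnihilator_ker] at hφ
  obtain ⟨ψ, rfl⟩ := hφ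
  refine ⟨dmk 0 ψ, dHom_ext Limits.comp_zero.symm fun h => ?_⟩
  exact (zero_add _).symm

/-- The order on the opposite category. -/
abbrev secondLTOp (F : IdealFiltration k C) (N : ℕ) (new : C → Prop)
    (X Y : (F.DExt N)ᵒᵖ) : Prop := F.secondLT N new X.unop Y.unop

namespace IsTildeLike

variable (H : F.IsTildeLike N new)

include H

/-- A map u[m] ⟶ x[i] with m < i, or with m = i and u ≠ x, is radical. Conversely, for j < i the
object y[j] is itself larger than x[i]. For j ≥ i the ℭ-component, being in I_1, factors through
y[i-1]. So does the form when I_{N-1}(x, y) = 0, that is, unless x is old and y is new. In that case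
y[i] is larger than x[i], and I_N = 0 suffices to factor through it. -/
theorem mem_notLeIdeal_right {x y : C} {i j : ℤ} (g : F.dObj N y j ⟶ F.dObj N x i) :
    g.op ∈ (notLeIdeal k (F.secondLTOp N new) (op (F.dObj N x i))).carrier
        (op (F.dObj N x i)) (op (F.dObj N y j)) ↔
      ∃ a ha, a ∈ F.zIdeal 1 y x ∧ g.1 = F.cmk N a ha := by
  have hop : ∀ ν : F.DExt N, ¬ (ν = F.dObj N x i ∨ F.secondLT N new ν (F.dObj N x i)) →
      ¬ (op ν = op (F.dObj N x i) ∨ F.secondLTOp N new (op ν) (op (F.dObj N x i))) :=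
    fun ν hν h => hν (h.imp (fun h => congrArg unop h) id)
  constructor
  · intro hg
    suffices h : (notLeIdeal k (F.secondLTOp N new) (op (F.dObj N x i))).carrier
        (op (F.dObj N x i)) (op (F.dObj N y j)) ≤
        ((F.homLayer N x i).carrier (fun y => F.zIdeal 1 y x) (F.dObj N y j)).comap
          (unopLin k (op (F.dObj N x i)) (op (F.dObj N y j))) from
      mem_homLayer_carrier (W := fun y => F.zIdeal 1 y x) (f := g).1 (h hg)
    refine notLeIdeal_le fun ν hν f g => ?_
    obtain ⟨⟨⟨u, m⟩⟩, rfl⟩ := op_surjective ν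
    obtain ⟨⟨f, φ⟩, rfl⟩ : ∃ f', f'.op = f := ⟨f.unop, rfl⟩
    obtain ⟨⟨g, ψ⟩, rfl⟩ : ∃ g', g'.op = g := ⟨g.unop, rfl⟩
    obtain ⟨a, ha, rfl⟩ := F.exists_cmk f
    obtain ⟨b, hb, rfl⟩ := F.exists_cmk g
    have hν' := not_le_cases (F := F) (N := N) (new := new) (x := x) (i := i) (u := u) (m := m)
      fun h => hν (h.imp (fun h => congrArg op h) id)
    refine mem_homLayer_carrier (W := fun y => F.zIdeal 1 y x) (i := i) (j := j)
      (f := dmk (F.cmk N b hb) ψ ≫ dmk (F.cmk N a ha) φ).2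
      ⟨b ≫ a, F.anti (by omega) _ _ (F.mul _ _ hb ha), ?_, rfl⟩
    rcases hν' with h | ⟨rfl, hu, -⟩
    · exact F.anti (by omega) _ _ (F.mul _ _ hb ha)
    · exact F.anti (by omega) _ _ (F.mul _ _ hb (H.mem_one_of_ne hu a))
  · rintro ⟨a, ha, ha1, hga⟩
    have hmul : ∀ {ν : F.DExt N}, ¬ (ν = F.dObj N x i ∨ F.secondLT N new ν (F.dObj N x i)) →
        ∀ (f : F.dObj N y j ⟶ ν) (g : ν ⟶ F.dObj N x i),
        (f ≫ g).op ∈ (notLeIdeal k (F.secondLTOp N new) (op (F.dObj N x i))).carrier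
          (op (F.dObj N x i)) (op (F.dObj N y j)) :=
      fun hν f g => comp_mem_notLeIdeal (hop _ hν) g.op f.op
    rcases lt_or_ge j i with hji | hji
    · rw [← Category.id_comp g]
      exact hmul (not_le_of_lt hji) _ _
    · obtain ⟨g, φ⟩ := g
      obtain rfl : g = _ := hga
      have e : (dmk (F.cmk N a ha) φ : F.dObj N y j ⟶ F.dObj N x i) =
          F.shift N y (by omega : i - 1 ≤ j) ≫
            dmk (F.cmk N a (F.zIdeal_anti (by omega) ha1)) 0 + dmk 0 φ := by
        refine dHom_ext ?_ fun h => ?_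
        · exact ((add_zero _).trans (cmk_id_comp F ha)).symm
        · exact ((congrArg (· + φ h) (add_zero _)).trans (zero_add _)).symm
      change (dmk (F.cmk N a ha) φ : F.dObj N y j ⟶ F.dObj N x i).op ∈ _
      rw [e, op_add]
      refine Submodule.add_mem _ (hmul (not_le_of_lt (by omega)) _ _) ?_
      by_cases hxy : ¬ new x ∧ new y
      · obtain ⟨g, hg⟩ := exists_dual_eq_shift_comp (l := i) hji
          (fun b hb => H.eq_zero_of_mem (by omega) hb) φ
        rw [hg]
        exact hmul (not_le_of_new hxy.1 hxy.2) _ _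
      · obtain ⟨g, hg⟩ := exists_dual_eq_shift_comp (l := i - 1) (by omega : i - 1 ≤ j) (fun b hb => by
          replace hb := F.zIdeal_anti (d := N - 1) (by omega) hb
          by_cases hx : new x
          · exact H.eq_zero_of_new hx hb
          · exact H.eq_zero_of_old (fun hy => hxy ⟨hx, hy⟩) hb) φ
        rw [hg]
        exact hmul (not_le_of_lt (by omega)) _ _

end IsTildeLike

namespace RightLayer

variable {x : C} {i : ℤ} (L : RightLayer.{w, v, u, t} F N x i) (H : F.IsTildeLike N new)

include H

/-- Between consecutive steps of `M` every family is stable: I_1 maps M_s into M_{s+1}, and modulo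
I_1 only scalar endomorphisms remain. -/
theorem act_mem_of_layer {s : ℤ} {W : ∀ y, Submodule k (L.V y)} (h1 : L.M (s + 1) ≤ W)
    (h2 : W ≤ L.M s) {y y' : C} (b : y' ⟶ y) {m : L.V y} (hm : m ∈ W y) : L.act b m ∈ W y' := by
  have key : ∀ {b : y' ⟶ y}, b ∈ F.ideal 1 y' y → L.act b m ∈ W y' := fun hb =>
    h1 _ (L.anti (by omega) _ (L.act_mem hb (h2 _ hm)))
  by_cases hy : y' = y
  · subst hy
    obtain ⟨c, hc⟩ := H.exists_scalar b
    have e : b = (b - c • 𝟙 y') + c • 𝟙 y' := by simp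
    rw [e, map_add, map_smul, LinearMap.add_apply, LinearMap.smul_apply, L.act_id]
    exact add_mem (key hc) (Submodule.smul_mem _ c hm)
  · exact key (H.mem_one_of_ne hy b)

/-- The vector `v` of M_s(u) adds nothing at u[j] for j < i - s, where M_{i-j} ⊆ M_{s+1} ⊆ W, and it
lies in the denominator for j ≥ i - s + N. In between it adds one dimension, killed by I_1 modulo W:
this is the right standard module at u[i-s]. -/
theorem isStdFiltered_step {s : ℤ} {W W' : ∀ y, Submodule k (L.V y)} (h1 : L.M (s + 1) ≤ W)
    {u : C} {v : L.V u} (hv : v ∈ L.M s u) (hvW : v ∉ W u)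
    (hu : W' u = W u ⊔ Submodule.span k {v}) (hne : ∀ y, y ≠ u → W' y = W y)
    (hW : ∀ {y y' : C} (b : y' ⟶ y) {m : L.V y}, m ∈ W y → L.act b m ∈ W y')
    (hW' : ∀ {y y' : C} (b : y' ⟶ y) {m : L.V y}, m ∈ W' y → L.act b m ∈ W' y')
    {p : (F.DExt N)ᵒᵖ → Prop} (hp : p (op (F.dObj N u (i - s))))
    (h : IsStdFiltered k (F.secondLTOp N new) p (L.sub W hW).toFunctor) :
    IsStdFiltered k (F.secondLTOp N new) p (L.sub W' hW').toFunctor := by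
  have hWW' : W ≤ W' := fun y => by
    by_cases hy : y = u
    · subst hy
      exact le_sup_left.trans hu.ge
    · exact (hne y hy).ge
  have hv' : v ∈ L.M (i - (i - s)) u := L.anti (by omega) _ hv
  refine ProjSub.isStdFiltered_of_generator (S' := L.sub W hW) ?_ hp (L.T u (i - s) ⟨v, hv'⟩).op
    ?_ ?_ ?_ h
  · rintro X f ⟨m, hm, hf⟩
    exact ⟨m, hWW' _ hm, hf⟩
  · refine ⟨⟨v, hv'⟩, ?_, ?_⟩
    · exact hu.ge (Submodule.mem_sup_right (Submodule.mem_span_singleton_self v))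
    · change L.T u (i - s) ⟨v, hv'⟩ - L.T u (i - s) ⟨v, hv'⟩ ∈ _
      rw [sub_self]
      exact Submodule.zero_mem _
  · intro X f hf
    obtain ⟨⟨⟨y, j⟩⟩, rfl⟩ := op_surjective X
    obtain ⟨f, rfl⟩ : ∃ f', f'.op = f := ⟨f.unop, rfl⟩
    obtain ⟨⟨m, hm⟩, hmW, hf⟩ := hf
    change m ∈ W' y at hmW
    have hm' : m ∈ L.M (i - j) y := hm
    change f - L.T y j ⟨m, hm⟩ ∈ L.base (F.dObj N y j) at hf
    suffices h : m ∈ W y ∨ ∃ g : F.dObj N y j ⟶ F.dObj N u (i - s),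
        f - g ≫ L.T u (i - s) ⟨v, hv'⟩ ∈ L.carrier W (F.dObj N y j) by
      rcases h with h | ⟨g, hg⟩
      · refine ⟨0, ⟨m, hm⟩, h, ?_⟩
        rw [Limits.comp_zero, sub_zero]
        exact hf
      · exact ⟨g.op, hg⟩
    by_cases hy : y = u
    · subst hy
      rw [hu, Submodule.mem_sup] at hmW
      obtain ⟨w, hw, v', hv1, rfl⟩ := hmW
      obtain ⟨c, rfl⟩ := Submodule.mem_span_singleton.1 hv1
      -- Below i - s nothing is new; from there on, c • v is reached from the generator by c times
      -- the shift u[j] ⟶ u[i-s].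
      rcases lt_or_ge j (i - s) with hj | hj
      · exact .inl (h1 _ (L.anti (by omega) _ hm'))
      · right
        have hvj : v ∈ L.M (i - j) y := L.anti (by omega) _ hv
        have hwj : w ∈ L.M (i - j) y := by
          have := sub_mem hm (Submodule.smul_mem _ c hvj)
          rwa [add_sub_cancel_right] at this
        have hT := L.T_comp (𝟙 y) (F.mem_zIdeal_of_nonpos (d := i - s - j) (by omega) _) 0 v hv'
          (by rwa [L.act_id])
        refine ⟨c • F.shift N y hj, ⟨w, hwj⟩, hw, ?_⟩
        have h3 := sub_mem hf (Submodule.smul_mem _ c hT)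
        have e1 : (⟨w + c • v, hm⟩ : L.M (i - j) y) = ⟨w, hwj⟩ + c • ⟨v, hvj⟩ := rfl
        have e2 : (⟨L.act (𝟙 y) v, by rwa [L.act_id]⟩ : L.M (i - j) y) = ⟨v, hvj⟩ :=
          Subtype.ext (L.act_id v)
        rw [e1, e2, map_add, map_smul, smul_sub] at h3
        rw [Linear.smul_comp]
        refine cast (congrArg (· ∈ L.base (F.dObj N y j)) ?_) h3
        unfold shift
        abel
    · exact .inl ((hne y hy).le hmW)
  · intro X g
    obtain ⟨⟨⟨y, j⟩⟩, rfl⟩ := op_surjective X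
    obtain ⟨g, rfl⟩ : ∃ g', g'.op = g := ⟨g.unop, rfl⟩
    rw [H.mem_notLeIdeal_right]
    obtain ⟨f, ψ⟩ := g
    obtain ⟨b, hb, rfl⟩ := F.exists_cmk f
    have key (b : y ⟶ u) (hb : b ∈ F.zIdeal (i - s - j) y u) :
        (dmk (F.cmk N b hb) ψ : F.dObj N y j ⟶ F.dObj N u (i - s)) ≫ L.T u (i - s) ⟨v, hv'⟩ ∈
          L.carrier W (F.dObj N y j) ↔
        ∃ m : L.M (i - j) y, m.1 ∈ W y ∧ L.act b v - m.1 ∈ L.M (N - (j - i)) y := by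
      have hT := L.T_comp b hb ψ v hv' (L.act_mem_M hb hv')
      refine exists_congr fun (m : L.M (i - j) y) => and_congr_right fun hm => ?_
      refine Iff.trans ?_ (L.T_mem (⟨L.act b v, L.act_mem_M hb hv'⟩ - m))
      rw [map_sub]
      change _ - L.T y j m ∈ _ ↔ _
      constructor <;> intro h3
      · have := sub_mem h3 hT
        rwa [sub_sub_sub_cancel_left] at this
      · have := add_mem hT h3
        rwa [sub_add_sub_cancel] at this
    change (dmk (F.cmk N b hb) ψ : F.dObj N y j ⟶ F.dObj N u (i - s)) ≫
      L.T u (i - s) ⟨v, hv'⟩ ∈ L.carrier W (F.dObj N y j) ↔ _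
    have hbv (b : y ⟶ u) (hb : b ∈ F.ideal 1 y u) : L.act b v ∈ W y :=
      h1 _ (L.anti (by omega) _ (L.act_mem hb hv))
    constructor
    · intro h3
      obtain ⟨m, hm, h3⟩ := (key b hb).1 h3
      rcases lt_or_ge j (i - s) with hj | hj
      · exact ⟨b, hb, F.zIdeal_anti (by omega) hb, rfl⟩
      -- Below this bound the denominator M_{N-(j-i)} lies in M_{s+1} ⊆ W, so b sends v into W; as v
      -- is not in W, b has no scalar part. Beyond the bound b is zero in ℭ and 0 represents it.
      rcases lt_or_ge j (i - s + N) with hj' | hj'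
      · have h4 : L.act b v ∈ W y := by
          have := add_mem (h1 _ (L.anti (by omega) _ h3)) hm
          rwa [sub_add_cancel] at this
        refine ⟨b, hb, ?_, rfl⟩
        by_cases hy : y = u
        · subst hy
          obtain ⟨c, hc⟩ := H.exists_scalar b
          have h5 := sub_mem h4 (hbv _ hc)
          rw [map_sub, map_smul, LinearMap.sub_apply, sub_sub_cancel, LinearMap.smul_apply,
            L.act_id] at h5
          have hc0 : c = 0 := by
            by_contra hc0
            exact hvW ((Submodule.smul_mem_iff _ hc0).1 h5)
          subst hc0
          exact (by simpa using hc : b ∈ F.ideal 1 y y)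
        · exact H.mem_one_of_ne hy b
      · refine ⟨0, Submodule.zero_mem _, Submodule.zero_mem _, ?_⟩
        exact (cmk_eq_zero F).2 (F.mem_zIdeal_of_nonpos (by omega) _)
    · rintro ⟨a, ha, ha1, hba⟩
      obtain hba : F.cmk N b hb = F.cmk N a ha := hba
      rw [hba]
      refine (key a ha).2 ⟨⟨L.act a v, L.act_mem_M ha hv'⟩, hbv a ha1, ?_⟩
      rw [sub_self]
      exact Submodule.zero_mem _

end RightLayer

end IdealFiltration

/-! ### Standard filtrations of the right projectives -/

namespace IdealFiltration

variable {k : Type w} [Field k] {C : Type u} [Category.{v} C] [Preadditive C] [Linear k C]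
  {F : IdealFiltration k C} {N : ℕ} {new : C → Prop}

namespace RightLayer

variable {x : C} {i : ℤ} (L : RightLayer.{w, v, u, t} F N x i)

theorem act_mem_M_self (s : ℤ) {y y' : C} (b : y' ⟶ y) {m : L.V y} (hm : m ∈ L.M s y) :
    L.act b m ∈ L.M s y' :=
  L.anti (by omega) _ (L.act_mem (a := 0) (by rw [F.zero]; exact Submodule.mem_top) hm)

/-- The submodule of `D(-, x[i])` given by a step of the filtration of the module of a layer. -/
def filtSub (s : ℤ) : ProjSub k (op (F.dObj N x i)) :=
  L.sub (L.M s) (L.act_mem_M_self s)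

variable (H : F.IsTildeLike N new)

include H

theorem isStdFiltered_filtSub_succ [∀ y, FiniteDimensional k (L.V y)] {s : ℤ}
    {p : (F.DExt N)ᵒᵖ → Prop}
    (hp : ∀ u, ∀ v ∈ L.M s u, v ∉ L.M (s + 1) u → p (op (F.dObj N u (i - s))))
    (h : IsStdFiltered k (F.secondLTOp N new) p (L.filtSub (s + 1)).toFunctor) :
    IsStdFiltered k (F.secondLTOp N new) p (L.filtSub s).toFunctor := by
  have := H.finite_obj
  have hle : L.M (s + 1) ≤ L.M s := L.anti (by omega)
  -- Stability is quantified inside the predicate since it is not among the data of a step; the two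
  -- bounds on `W` supply it when needed.
  refine (Submodule.family_induction (fun W => L.M (s + 1) ≤ W ∧ W ≤ L.M s ∧
    ∀ hW : (∀ {y y' : C} (b : y' ⟶ y) {m : L.V y}, m ∈ W y → L.act b m ∈ W y'),
      IsStdFiltered k (F.secondLTOp N new) p (L.sub W @hW).toFunctor) hle
    ⟨le_rfl, hle, fun _ => h⟩ ?_).2.2 (L.act_mem_M_self s)
  rintro W W' u v hAW hWB hv hvW hu hne ⟨-, -, hW⟩
  have hAW' : L.M (s + 1) ≤ W' := hAW.trans fun y => by
    by_cases hy : y = u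
    · subst hy
      exact le_sup_left.trans hu.ge
    · exact (hne y hy).ge
  have hW'B : W' ≤ L.M s := fun y => by
    by_cases hy : y = u
    · subst hy
      rw [hu]
      exact sup_le (hWB y) (by simpa using hv)
    · exact (hne y hy).le.trans (hWB y)
  exact ⟨hAW', hW'B, fun hst => L.isStdFiltered_step H hAW hv hvW hu hne
    (L.act_mem_of_layer H hAW hWB) @hst (hp u v hv fun h => hvW (hAW u h)) (hW _)⟩

theorem isStdFiltered_filtSub [∀ y, FiniteDimensional k (L.V y)] {s₀ : ℤ} (hs₀ : s₀ ≤ N)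
    {p : (F.DExt N)ᵒᵖ → Prop}
    (hp : ∀ s, s₀ ≤ s → ∀ u, ∀ v ∈ L.M s u, v ∉ L.M (s + 1) u → p (op (F.dObj N u (i - s))))
    (h : IsStdFiltered k (F.secondLTOp N new) p (L.filtSub N).toFunctor) :
    IsStdFiltered k (F.secondLTOp N new) p (L.filtSub s₀).toFunctor := by
  suffices key : ∀ n : ℕ, ∀ s : ℤ, s + n = N → s₀ ≤ s →
      IsStdFiltered k (F.secondLTOp N new) p (L.filtSub s).toFunctor from
    key (N - s₀).toNat s₀ (by omega) le_rfl
  intro n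
  induction n with
  | zero =>
    intro s hs _
    obtain rfl : s = N := by omega
    exact h
  | succ n ih =>
    intro s hs hss
    exact L.isStdFiltered_filtSub_succ H (hp s hss) (ih (s + 1) (by omega) (by omega))

end RightLayer

namespace IsTildeLike

variable (H : F.IsTildeLike N new)

include H

/-- The chain starts at M_N, the annihilator of I_0, which is zero. The delicate end is s = 0: a
form outside M_1(u) is nonzero on I_{N-1}(x, u), so x is old, u is new, and u[i] is larger than
x[i]. -/
theorem isStdFiltered_dualLayer (x : C) (i : ℤ) :
    IsStdFiltered k (F.secondLTOp N new) (fun m => F.secondLTOp N new (op (F.dObj N x i)) m)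
      ((F.dualLayer N x i).filtSub 0).toFunctor := by
  have : ∀ y, FiniteDimensional k ((F.dualLayer N x i).V y) := fun y => by
    have := H.finite_hom x y
    exact inferInstanceAs (FiniteDimensional k (Module.Dual k (x ⟶ y)))
  refine (F.dualLayer N x i).isStdFiltered_filtSub H (by omega) (fun s hs u v hv hv' => ?_) ?_
  · rcases hs.lt_or_eq with hs | rfl
    · exact .inl (show i - s < i by omega)
    · refine .inr ⟨sub_zero i, ?_⟩
      obtain ⟨v, rfl⟩ : ∃ v' : Module.Dual k (x ⟶ u), v' = v := ⟨v, rfl⟩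
      replace hv' : v ∉ (F.zIdeal (N - (0 + 1)) x u).dualAnnihilator := hv'
      have hne : ∃ b ∈ F.zIdeal (N - (0 + 1)) x u, b ≠ 0 := by
        by_contra! h
        refine hv' ((Submodule.mem_dualAnnihilator _).2 fun b hb => ?_)
        rw [h b hb, map_zero]
      obtain ⟨b, hb, hb0⟩ := hne
      rw [zero_add] at hb
      exact ⟨fun hx => hb0 (H.eq_zero_of_new hx hb),
        by_contra fun hu => hb0 (H.eq_zero_of_old hu hb)⟩
  · refine ProjSub.isStdFiltered_of_eq_bot fun X => ?_
    obtain ⟨⟨⟨y, j⟩⟩, rfl⟩ := op_surjective X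
    refine (Submodule.eq_bot_iff _).2 fun f hf => ?_
    obtain ⟨⟨m, hm⟩, hm', hf⟩ := hf
    have h0 : m = 0 := LinearMap.ext fun b =>
      (Submodule.mem_dualAnnihilator m).1 hm' b (F.mem_zIdeal_of_nonpos (by omega) b)
    subst h0
    have h1 := (Submodule.mem_bot k).1 hf
    have h2 : (F.dualLayer N x i).T y j ⟨0, hm⟩ = 0 := map_zero ((F.dualLayer N x i).T y j)
    replace h1 := h1.trans (by exact rfl : (0 : F.dObj N y j ⟶ F.dObj N x i) = 0)
    exact Quiver.Hom.unop_inj ((sub_eq_zero.1 h1).trans h2)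

/-- This glues the two layers. Since I_N = 0, both sides consist of all morphisms with zero
ℭ-component. -/
theorem homLayer_filtSub_eq (x : C) (i : ℤ) :
    (F.homLayer N x i).filtSub N = (F.dualLayer N x i).filtSub 0 := by
  ext X f
  obtain ⟨⟨⟨y, j⟩⟩, rfl⟩ := op_surjective X
  obtain ⟨⟨f, φ⟩, rfl⟩ : ∃ f', f'.op = f := ⟨f.unop, rfl⟩
  refine (mem_homLayer_carrier (f := dmk f φ)).trans ⟨?_, ?_⟩
  · rintro ⟨a, ha, haN, hfa⟩
    obtain rfl := H.eq_zero_of_mem le_rfl haN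
    obtain rfl : f = 0 := hfa
    obtain ⟨Ψ, hΨ⟩ := F.exists_dualDesc N x i φ
    refine ⟨Ψ, (Submodule.mem_dualAnnihilator _).2 fun b hb => ?_, ?_⟩
    · rw [H.eq_zero_of_mem (by omega) hb, map_zero]
    · exact (Submodule.mem_bot k).2 (sub_eq_zero.2 (Prod.ext rfl hΨ.symm))
  · rintro ⟨m, hm, hf⟩
    have h1 := sub_eq_zero.1 ((Submodule.mem_bot k).1 hf)
    exact ⟨0, Submodule.zero_mem _, Submodule.zero_mem _, congrArg Prod.fst h1⟩

theorem hasStandardFiltrationsRight :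
    HasStandardFiltrationsLeft (D := (F.DExt N)ᵒᵖ) k (F.secondLTOp N new) := by
  intro X
  obtain ⟨⟨⟨x, i⟩⟩, rfl⟩ := op_surjective X
  have hN := H.one_le x
  constructor
  · refine finrank_stdModule_eq_one (fun h => ?_) fun f => ?_
    · obtain ⟨a, ha, ha1, h1⟩ := (H.mem_notLeIdeal_right (𝟙 (F.dObj N x i))).1 h
      replace h1 : F.cmk N (𝟙 x) (F.mem_zIdeal_of_nonpos (by omega) _) = F.cmk N a ha := h1
      rw [cmk_eq_cmk] at h1
      have h2 := sub_eq_zero.1 (H.eq_zero_of_mem (by omega) h1)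
      exact H.id_notMem x (h2 ▸ ha1)
    · obtain ⟨⟨f, φ⟩, rfl⟩ : ∃ f', f'.op = f := ⟨f.unop, rfl⟩
      obtain ⟨a, ha, rfl⟩ := F.exists_cmk f
      obtain ⟨c, hc⟩ := H.exists_scalar a
      refine ⟨c, (H.mem_notLeIdeal_right (dmk (F.cmk N a ha) φ - c • 𝟙 (F.dObj N x i))).2
        ⟨a - c • 𝟙 x, F.mem_zIdeal_of_nonpos (by omega) _, hc, rfl⟩⟩
  · refine isStdFiltered_kernel_stdProj ?_
    have : ∀ y, FiniteDimensional k ((F.homLayer N x i).V y) := fun y => H.finite_hom y x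
    -- The kernel is the step s = 1 of the ℭ-layer, so only s ≥ 1 occurs there and all indices i - s
    -- are below i.
    have key : notLeSub k (F.secondLTOp N new) (op (F.dObj N x i)) =
        (F.homLayer N x i).filtSub 1 := by
      ext X f
      obtain ⟨⟨⟨y, j⟩⟩, rfl⟩ := op_surjective X
      exact (H.mem_notLeIdeal_right f.unop).trans
        (mem_homLayer_carrier (W := fun y => F.zIdeal 1 y x) (f := f.unop)).symm
    change IsStdFiltered k _ _ (notLeSub k (F.secondLTOp N new) (op (F.dObj N x i))).toFunctor
    rw [key]
    refine (F.homLayer N x i).isStdFiltered_filtSub H (by omega) (fun s hs u v hv hv' => ?_) ?_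
    · exact .inl (show i - s < i by omega)
    · rw [H.homLayer_filtSub_eq]
      exact H.isStdFiltered_dualLayer x i

end IsTildeLike

end IdealFiltration

/-! ### Local endomorphism rings, finiteness, and the quasi-hereditary structure -/

theorem isLocalRing_of_isUnit_or_isNilpotent {E : Type*} [Ring E] [Nontrivial E]
    (h : ∀ e : E, IsUnit e ∨ IsNilpotent e) : IsLocalRing E where
  isUnit_or_isUnit_of_add_one {a b} hab := by
    rcases h a with ha | ha
    · exact .inl ha
    · rw [← eq_sub_iff_add_eq'] at hab
      exact .inr (hab ▸ ha.isUnit_one_sub)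

namespace IdealFiltration

variable {k : Type w} [Field k] {C : Type u} [Category.{v} C] [Preadditive C] [Linear k C]
  {F : IdealFiltration k C} {N : ℕ} {new : C → Prop}

/-- The N-th power has its ℭ-component in I_N modulo I_N, so it is purely dual, and two purely dual
morphisms compose to zero. Hence the exponent 2N. -/
theorem isNilpotent_of_mem {x : C} {i : ℤ} {a : x ⟶ x} (ha : a ∈ F.zIdeal (i - i) x x)
    (ha1 : a ∈ F.ideal 1 x x) (φ : Module.Dual k (F.cObj N x i ⟶ F.cObj N x i)) :
    IsNilpotent (show End (F.dObj N x i) from dmk (F.cmk N a ha) φ) := by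
  set e : End (F.dObj N x i) := dmk (F.cmk N a ha) φ with he
  have key : ∀ n : ℕ, ∃ b hb, b ∈ F.ideal n x x ∧
      (show F.dObj N x i ⟶ F.dObj N x i from e ^ n).1 = F.cmk N b hb := by
    intro n
    induction n with
    | zero =>
      refine ⟨𝟙 x, F.mem_zIdeal_of_nonpos (by omega) _, ?_, rfl⟩
      rw [F.zero]
      exact Submodule.mem_top
    | succ n ih =>
      obtain ⟨b, hb, hbn, h⟩ := ih
      refine ⟨a ≫ b, F.mem_zIdeal_of_nonpos (by omega) _,
        F.anti (by omega) _ _ (F.mul _ _ ha1 hbn), ?_⟩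
      rw [pow_succ]
      change F.cmk N a ha ≫ (show F.dObj N x i ⟶ F.dObj N x i from e ^ n).1 = _
      rw [h]
      rfl
  obtain ⟨b, hb, hbN, h⟩ := key N
  have h0 : (show F.dObj N x i ⟶ F.dObj N x i from e ^ N).1 = 0 := by
    rw [h]
    exact (cmk_eq_zero F).2 (F.anti (by omega) _ _ hbN)
  refine ⟨N * 2, ?_⟩
  rw [pow_mul, pow_two]
  refine dHom_ext ?_ fun f => ?_
  · change _ ≫ (show F.dObj N x i ⟶ F.dObj N x i from e ^ N).1 = 0
    rw [h0, Limits.comp_zero]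
  · refine (dComp_snd (show F.dObj N x i ⟶ F.dObj N x i from e ^ N) _ f).trans ?_
    rw [h0, Limits.zero_comp, Limits.comp_zero, map_zero, add_zero]
    rfl

namespace IsTildeLike

variable (H : F.IsTildeLike N new)

include H

/-- Modulo I_1 an endomorphism of x is a scalar c. For c = 0 the endomorphism of x[i] is nilpotent;
otherwise it is c times a unipotent one. -/
theorem isLocalRing_end (X : F.DExt N) : IsLocalRing (End X) := by
  obtain ⟨⟨⟨x, i⟩⟩⟩ := X
  have : Nontrivial (End (F.dObj N x i)) := by
    refine ⟨⟨𝟙 _, 0, fun h => ?_⟩⟩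
    have h1 : F.cmk N (i := i) (j := i) (𝟙 x) (F.mem_zIdeal_of_nonpos (by omega) _) = 0 :=
      congrArg Prod.fst h
    have h2 := H.eq_zero_of_mem (by omega) ((cmk_eq_zero F).1 h1)
    exact H.id_notMem x (h2 ▸ Submodule.zero_mem _)
  refine isLocalRing_of_isUnit_or_isNilpotent fun e => ?_
  obtain ⟨f, φ⟩ := e
  obtain ⟨a, ha, rfl⟩ := F.exists_cmk f
  obtain ⟨c, hc⟩ := H.exists_scalar a
  by_cases hc0 : c = 0
  · subst hc0
    exact .inr (isNilpotent_of_mem ha (by simpa using hc) φ)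
  · left
    have hr : c⁻¹ • (a - c • 𝟙 x) ∈ F.ideal 1 x x := Submodule.smul_mem _ _ hc
    have hn := isNilpotent_of_mem (i := i) (F.mem_zIdeal_of_nonpos (by omega) _) hr (c⁻¹ • φ)
    have hu : IsUnit (show End (F.dObj N x i) from c • 𝟙 (F.dObj N x i)) := by
      refine ⟨⟨c • 𝟙 (F.dObj N x i), c⁻¹ • 𝟙 (F.dObj N x i), ?_, ?_⟩, rfl⟩
      · change (c⁻¹ • 𝟙 (F.dObj N x i)) ≫ (c • 𝟙 (F.dObj N x i)) = 𝟙 _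
        rw [Linear.comp_smul, Category.comp_id, smul_smul, mul_inv_cancel₀ hc0, one_smul]
      · change (c • 𝟙 (F.dObj N x i)) ≫ (c⁻¹ • 𝟙 (F.dObj N x i)) = 𝟙 _
        rw [Linear.comp_smul, Category.comp_id, smul_smul, inv_mul_cancel₀ hc0, one_smul]
    refine (congrArg IsUnit ?_).mpr (hu.mul hn.isUnit_one_add)
    change (dmk (F.cmk N a ha) φ : F.dObj N x i ⟶ F.dObj N x i) =
      (𝟙 (F.dObj N x i) + dmk (F.cmk N (c⁻¹ • (a - c • 𝟙 x)) _) (c⁻¹ • φ)) ≫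
        (c • 𝟙 (F.dObj N x i))
    rw [Linear.comp_smul, Category.comp_id]
    refine Prod.ext ?_ ?_
    · change F.cmk N a ha = F.cmk N (c • (𝟙 x + c⁻¹ • (a - c • 𝟙 x))) _
      congr 1
      rw [smul_add, smul_smul, mul_inv_cancel₀ hc0, one_smul, add_sub_cancel]
    · change φ = c • (0 + c⁻¹ • φ)
      rw [zero_add, smul_smul, mul_inv_cancel₀ hc0, one_smul]

/-- The identity of x would be a composite a ≫ b. Different vertices or i < j put a into I_1, and j
< i puts b there; both contradict that the identity is not in I_1. -/
theorem eq_of_iso (X Y : F.DExt N) (h : Nonempty (X ≅ Y)) : X = Y := by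
  obtain ⟨e⟩ := h
  obtain ⟨⟨⟨x, i⟩⟩⟩ := X
  obtain ⟨⟨⟨y, j⟩⟩⟩ := Y
  obtain ⟨a, ha, hea⟩ := F.exists_cmk e.hom.1
  obtain ⟨b, hb, heb⟩ := F.exists_cmk e.inv.1
  have h1 : F.cmk N a ha ≫ F.cmk N b hb = F.cmk N (i := i) (j := i) (𝟙 x)
      (F.mem_zIdeal_of_nonpos (by omega) _) := by
    rw [← hea, ← heb]
    exact congrArg Prod.fst e.hom_inv_id
  rw [cmk_comp, cmk_eq_cmk] at h1
  have h2 := sub_eq_zero.1 (H.eq_zero_of_mem (by omega) h1)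
  have key (h : a ∈ F.zIdeal 1 x y ∨ b ∈ F.zIdeal 1 y x) : False := by
    refine H.id_notMem x (h2 ▸ ?_)
    rcases h with h | h
    · exact F.anti (by omega) _ _ (F.mul _ _ h hb)
    · exact F.anti (by omega) _ _ (F.mul _ _ ha h)
  by_cases hxy : x = y
  · subst hxy
    rcases lt_trichotomy i j with hij | rfl | hij
    · exact (key (.inl (F.zIdeal_anti (by omega) ha))).elim
    · rfl
    · exact (key (.inr (F.zIdeal_anti (by omega) hb))).elim
  · exact (key (.inl (H.mem_one_of_ne hxy a))).elim

/-- At one end the numerator is contained in I_N = 0, at the other the denominator is I_0. -/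
theorem cHom_eq_zero {x y : C} {i j : ℤ} (h : i + N ≤ j ∨ j + N ≤ i)
    (f : F.cObj N x i ⟶ F.cObj N y j) : f = 0 := by
  obtain ⟨a, ha, rfl⟩ := F.exists_cmk f
  refine (cmk_eq_zero F).2 ?_
  rcases h with h | h
  · rw [H.eq_zero_of_mem (by omega) ha]
    exact Submodule.zero_mem _
  · exact F.mem_zIdeal_of_nonpos (by omega) _

theorem abs_lt_of_nontrivial {x y : C} {i j : ℤ}
    (h : Nontrivial (F.dObj N x i ⟶ F.dObj N y j)) : j < i + N ∧ i < j + N := by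
  by_contra hij
  refine (not_subsingleton_iff_nontrivial.2 h) ⟨fun f g => dHom_ext ?_ fun q => ?_⟩
  · rw [H.cHom_eq_zero (by omega) f.1, H.cHom_eq_zero (by omega) g.1]
  · rw [H.cHom_eq_zero (by omega) q, map_zero, map_zero]

theorem isBasicLocallyBounded : IsBasicLocallyBounded k (F.DExt N) := by
  have := H.finite_obj
  have hfin (i : ℤ) : ((fun p : C × ℤ => F.dObj N p.1 p.2) ''
      (Set.univ ×ˢ Set.Icc (i - N) (i + N))).Finite := (Set.toFinite _).image _
  refine ⟨H.isLocalRing_end, H.eq_of_iso, fun X Y => ?_, fun X => ?_, fun Y => ?_⟩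
  · obtain ⟨⟨⟨x, i⟩⟩⟩ := X
    obtain ⟨⟨⟨y, j⟩⟩⟩ := Y
    have hc (x y : C) (i j : ℤ) : FiniteDimensional k (F.cObj N x i ⟶ F.cObj N y j) := by
      have := H.finite_hom x y
      exact inferInstanceAs (FiniteDimensional k (F.bHom (⟨x, i⟩ : F.BObj) ⟨y, j⟩ ⧸ _))
    have := hc x y i j
    have := hc y x j i
    exact inferInstanceAs (FiniteDimensional k
      ((F.cObj N x i ⟶ F.cObj N y j) × Module.Dual k (F.cObj N y j ⟶ F.cObj N x i)))
  · obtain ⟨⟨⟨x, i⟩⟩⟩ := X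
    refine (hfin i).subset fun Y hY => ?_
    obtain ⟨⟨⟨y, j⟩⟩⟩ := Y
    have := H.abs_lt_of_nontrivial hY
    exact ⟨(y, j), ⟨trivial, by simp only [Set.mem_Icc]; omega⟩, rfl⟩
  · obtain ⟨⟨⟨x, i⟩⟩⟩ := Y
    refine (hfin i).subset fun Y hY => ?_
    obtain ⟨⟨⟨y, j⟩⟩⟩ := Y
    have := H.abs_lt_of_nontrivial hY
    exact ⟨(y, j), ⟨trivial, by simp only [Set.mem_Icc]; omega⟩, rfl⟩

theorem isQuasiHereditary : IsQuasiHereditary k (F.DExt N) (F.secondLT N new) where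
  basic := H.isBasicLocallyBounded
  order :=
    { irrefl := fun X h => h.elim (lt_irrefl _) fun h => h.2.1 h.2.2
      trans := fun X Y Z h h' => by
        rcases h with h | ⟨h, h1, h2⟩ <;> rcases h' with h' | ⟨h', h1', h2'⟩
        · exact .inl (h'.trans h)
        · exact .inl (h'.trans_lt h)
        · exact .inl (h'.trans_le h.le)
        · exact absurd h2 h1' }
  left := H.hasStandardFiltrationsLeft
  right := H.hasStandardFiltrationsRight

end IsTildeLike

end IdealFiltration

/-! ## The path category of a quiver with relations -/

section Paths

variable {k : Type w} [Field k] {W : Type u} [Quiver.{v} W]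

theorem Quiver.Path.finite_length_lt [Finite W] [∀ x y : W, Finite (x ⟶ y)] (x : W) (n : ℕ) :
    ∀ y : W, {p : Quiver.Path x y | p.length < n}.Finite := by
  induction n with
  | zero => simp
  | succ n ih =>
    intro y
    have h1 : {p : Quiver.Path x y | p.length = 0}.Subsingleton := by
      intro p hp q hq
      obtain rfl := Quiver.Path.eq_of_length_zero p hp
      rw [Quiver.Path.eq_nil_of_length_zero p hp, Quiver.Path.eq_nil_of_length_zero q hq]
    have h2 : (⋃ z : W, ⋃ a : z ⟶ y,
        (fun p => Quiver.Path.cons p a) '' {p : Quiver.Path x z | p.length < n}).Finite :=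
      Set.finite_iUnion fun z => Set.finite_iUnion fun a => (ih z).image _
    refine (h1.finite.union h2).subset fun p hp => ?_
    cases p with
    | nil => exact .inl rfl
    | cons q a =>
      refine .inr (Set.mem_iUnion.2 ⟨_, Set.mem_iUnion.2 ⟨a, q, ?_, rfl⟩⟩)
      simpa using hp

/-- A vertex as an object of the linearized path category. -/
abbrev pathObj (k : Type w) [Field k] (x : W) : Free k (Paths W) := x

/-- The linear combinations of paths from `x` to `y`. -/
abbrev PathComb (k : Type w) [Field k] (x y : W) := pathObj k x ⟶ pathObj k y

variable (k) in
/-- The combinations of paths of length at least `n`. -/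
def pathsGE (n : ℕ) (x y : W) : Submodule k (PathComb k x y) :=
  Finsupp.supported k k {p : Quiver.Path x y | n ≤ p.length}

/-- A path as a morphism of the linearized path category. -/
noncomputable def pathHom (k : Type w) [Field k] {x y : W} (p : Quiver.Path x y) :
    PathComb k x y :=
  (Finsupp.single p 1 : Quiver.Path x y →₀ k)

theorem pathHom_comp {x y z : W} (p : Quiver.Path x y) (q : Quiver.Path y z) :
    pathHom k p ≫ pathHom k q = pathHom k (p.comp q) :=
  (Free.single_comp_single (R := k) (C := Paths W) p q 1 1).trans (by rw [one_mul]; rfl)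

theorem pathHom_mem {n : ℕ} {x y : W} {p : Quiver.Path x y} (h : n ≤ p.length) :
    pathHom k p ∈ pathsGE k n x y :=
  Finsupp.single_mem_supported k 1 h

theorem pathHom_mem_iff {n : ℕ} {x y : W} {p : Quiver.Path x y} :
    pathHom k p ∈ pathsGE k n x y ↔ n ≤ p.length := by
  refine ⟨fun h => ?_, pathHom_mem⟩
  exact h (by simp [pathHom])

theorem pathsGE_eq_span (n : ℕ) (x y : W) :
    pathsGE k n x y = Submodule.span k (pathHom k '' {p : Quiver.Path x y | n ≤ p.length}) :=
  Finsupp.supported_eq_span_single k _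

theorem span_pathHom (x y : W) :
    Submodule.span k (Set.range (pathHom k : Quiver.Path x y → PathComb k x y)) = ⊤ := by
  have h := pathsGE_eq_span (k := k) 0 x y
  simp only [Nat.zero_le, Set.ofPred_true, Set.image_univ] at h
  rw [← h]
  exact eq_top_iff.2 fun f _ p _ => Nat.zero_le _

theorem pathsGE_induction {n : ℕ} {x y : W} {T : Submodule k (PathComb k x y)}
    (h : ∀ p : Quiver.Path x y, n ≤ p.length → pathHom k p ∈ T) : pathsGE k n x y ≤ T := by
  rw [pathsGE_eq_span, Submodule.span_le]
  rintro _ ⟨p, hp, rfl⟩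
  exact h p hp

theorem pathHom_induction {x y : W} {T : Submodule k (PathComb k x y)}
    (h : ∀ p : Quiver.Path x y, pathHom k p ∈ T) (f : PathComb k x y) :
    f ∈ T := by
  have : f ∈ (⊤ : Submodule k (PathComb k x y)) := Submodule.mem_top
  rw [← span_pathHom] at this
  refine Submodule.span_le.2 ?_ this
  rintro _ ⟨p, rfl⟩
  exact h p

theorem pathsGE_zero (x y : W) : pathsGE k 0 x y = ⊤ := by
  refine eq_top_iff.2 fun f _ => pathHom_induction (fun p => pathHom_mem (Nat.zero_le _)) f

theorem pathsGE_mul {a b : ℕ} {x y z : W} {f : PathComb k x y}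
    {g : PathComb k y z} (hf : f ∈ pathsGE k a x y)
    (hg : g ∈ pathsGE k b y z) : f ≫ g ∈ pathsGE k (a + b) x z := by
  have h1 : ∀ p : Quiver.Path x y, a ≤ p.length → pathHom k p ≫ g ∈ pathsGE k (a + b) x z := by
    intro p hp
    refine pathsGE_induction (T := (pathsGE k (a + b) x z).comap
      (Linear.leftComp k (pathObj k z) (pathHom k p))) (fun q hq => ?_) hg
    change pathHom k p ≫ pathHom k q ∈ pathsGE k (a + b) x z
    rw [pathHom_comp]
    refine pathHom_mem ?_
    rw [Quiver.Path.length_comp]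
    omega
  exact pathsGE_induction (T := (pathsGE k (a + b) x z).comap
      (Linear.rightComp k (pathObj k x) g)) h1 hf

theorem pathsGE_anti {a b : ℕ} (h : a ≤ b) (x y : W) : pathsGE k b x y ≤ pathsGE k a x y :=
  pathsGE_induction fun _ hp => pathHom_mem (h.trans hp)

namespace QuiverRelations

variable (S : QuiverRelations k W)

/-- The vertices as objects of `kQ / ⟨R⟩`. -/
abbrev vtx (x : W) : S.Cat := ⟨pathObj k x⟩

/-- The image in `kQ / ⟨R⟩` of a combination of paths. -/
noncomputable def qmap (x y : W) : (PathComb k x y) →ₗ[k] (S.vtx x ⟶ S.vtx y) :=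
  (S.ideal.carrier (pathObj k x) (pathObj k y)).mkQ

variable {S}

theorem qmap_comp {x y z : W} (f : PathComb k x y)
    (g : PathComb k y z) :
    S.qmap x y f ≫ S.qmap y z g = S.qmap x z (f ≫ g) := rfl

theorem qmap_eq_zero {x y : W} {f : PathComb k x y} :
    S.qmap x y f = 0 ↔ f ∈ S.ideal.carrier (pathObj k x) (pathObj k y) :=
  Submodule.Quotient.mk_eq_zero _

theorem qmap_surjective (x y : W) : Function.Surjective (S.qmap x y) :=
  Submodule.mkQ_surjective _

/-- The ideal of the arrows of `kQ / ⟨R⟩`. -/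
noncomputable def arrowIdeal (S : QuiverRelations k W) (x y : W) : Submodule k (S.vtx x ⟶ S.vtx y) :=
  (pathsGE k 1 x y).map (S.qmap x y)

theorem arrowIdeal_comp {x y z : W} {f : S.vtx x ⟶ S.vtx y} (g : S.vtx y ⟶ S.vtx z)
    (hf : f ∈ S.arrowIdeal x y) : f ≫ g ∈ S.arrowIdeal x z := by
  obtain ⟨f, hf, rfl⟩ := hf
  obtain ⟨g, rfl⟩ := qmap_surjective _ _ g
  refine ⟨f ≫ g, pathsGE_mul (b := 0) hf ?_, rfl⟩
  rw [pathsGE_zero]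
  exact Submodule.mem_top

theorem comp_arrowIdeal {x y z : W} (f : S.vtx x ⟶ S.vtx y) {g : S.vtx y ⟶ S.vtx z}
    (hg : g ∈ S.arrowIdeal y z) : f ≫ g ∈ S.arrowIdeal x z := by
  obtain ⟨g, hg, rfl⟩ := hg
  obtain ⟨f, rfl⟩ := qmap_surjective _ _ f
  refine ⟨f ≫ g, pathsGE_anti (a := 1) (b := 0 + 1) le_rfl _ _ (pathsGE_mul ?_ hg), rfl⟩
  rw [pathsGE_zero]
  exact Submodule.mem_top

theorem ideal_le (h : ∀ x y : W, ∀ r ∈ S x y, ∀ p ∈ r.support, 2 ≤ p.length) (x y : W) :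
    S.ideal.carrier (pathObj k x) (pathObj k y) ≤ pathsGE k 2 x y := by
  refine Submodule.span_le.2 ?_
  rintro _ ⟨(A : W), (B : W), (f : PathComb k x A), (r : PathComb k A B), (g : PathComb k B y),
    hr, rfl⟩
  have hf : f ∈ pathsGE k 0 x A := by
    rw [pathsGE_zero]
    exact Submodule.mem_top
  have hg : g ∈ pathsGE k 0 B y := by
    rw [pathsGE_zero]
    exact Submodule.mem_top
  exact pathsGE_anti (a := 2) (b := 0 + (2 + 0)) (by omega) _ _ (pathsGE_mul hf (pathsGE_mul
    (show r ∈ pathsGE k 2 A B from fun p hp => h A B r hr p hp) hg))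

theorem pathsGE_le (h : ∃ m : ℕ, ∀ (x y : W) (p : Quiver.Path x y), m ≤ p.length →
      (Finsupp.single p 1 : Quiver.Path x y →₀ k) ∈ S.ideal.carrier x y) :
    ∃ m : ℕ, ∀ x y : W, pathsGE k m x y ≤ S.ideal.carrier (pathObj k x) (pathObj k y) :=
  h.imp fun _ hm x y => pathsGE_induction fun p hp => hm x y p hp

theorem arrowIdeal_of_ne {x y : W} (h : x ≠ y) : S.arrowIdeal x y = ⊤ := by
  refine eq_top_iff.2 fun f _ => ?_
  obtain ⟨f, rfl⟩ := qmap_surjective _ _ f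
  refine ⟨f, pathHom_induction (fun p => pathHom_mem ?_) f, rfl⟩
  by_contra hp
  exact h (Quiver.Path.eq_of_length_zero p (by omega))

theorem exists_sub_smul_mem_arrowIdeal {x : W} (f : S.vtx x ⟶ S.vtx x) :
    ∃ c : k, f - c • 𝟙 (S.vtx x) ∈ S.arrowIdeal x x := by
  have key : f ∈ Submodule.span k {𝟙 (S.vtx x)} ⊔ S.arrowIdeal x x := by
    obtain ⟨f, rfl⟩ := qmap_surjective _ _ f
    refine pathHom_induction (T := (Submodule.span k {𝟙 (S.vtx x)} ⊔ S.arrowIdeal x x).comap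
      (S.qmap x x)) (fun p => ?_) f
    by_cases hp : p.length = 0
    · obtain rfl := Quiver.Path.eq_nil_of_length_zero p hp
      exact Submodule.mem_sup_left (Submodule.mem_span_singleton_self _)
    · exact Submodule.mem_sup_right ⟨_, pathHom_mem (by omega), rfl⟩
  obtain ⟨a, ha, b, hb, rfl⟩ := Submodule.mem_sup.1 key
  obtain ⟨c, rfl⟩ := Submodule.mem_span_singleton.1 ha
  exact ⟨c, by rwa [add_sub_cancel_left]⟩

theorem id_notMem_arrowIdeal (h : ∀ x y : W, ∀ r ∈ S x y, ∀ p ∈ r.support, 2 ≤ p.length) (x : W) :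
    𝟙 (S.vtx x) ∉ S.arrowIdeal x x := by
  rintro ⟨f, hf, hf1⟩
  replace hf1 : S.qmap x x f = S.qmap x x (pathHom k .nil) := hf1
  rw [← sub_eq_zero, ← map_sub, qmap_eq_zero] at hf1
  have h1 := sub_mem hf (pathsGE_anti (a := 1) (by omega) _ _ (ideal_le h x x hf1))
  rw [sub_sub_cancel, pathHom_mem_iff] at h1
  simp at h1

theorem isNilpotent_of_mem_arrowIdeal
    (h : ∃ m : ℕ, ∀ x y : W, pathsGE k m x y ≤ S.ideal.carrier (pathObj k x) (pathObj k y)) {x : W}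
    {f : End (S.vtx x)} (hf : (show S.vtx x ⟶ S.vtx x from f) ∈ S.arrowIdeal x x) :
    IsNilpotent f := by
  obtain ⟨m, hm⟩ := h
  obtain ⟨g, hg, rfl⟩ := hf
  have key : ∀ n : ℕ, ∃ g' ∈ pathsGE k n x x,
      (show End (S.vtx x) from S.qmap x x g) ^ n = S.qmap x x g' := by
    intro n
    induction n with
    | zero =>
      refine ⟨𝟙 _, ?_, rfl⟩
      rw [pathsGE_zero]
      exact Submodule.mem_top
    | succ n ih =>
      obtain ⟨g', hg', h⟩ := ih
      refine ⟨g ≫ g', pathsGE_anti (by omega) _ _ (pathsGE_mul hg hg'), ?_⟩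
      rw [pow_succ, h]
      rfl
  obtain ⟨g', hg', h⟩ := key m
  exact ⟨m, h.trans (qmap_eq_zero.2 (hm x x hg'))⟩

/-- Endomorphisms in the arrow ideal are nilpotent because long paths are relations, so the arrow
ideal is radical. Conversely, modulo it an endomorphism is a scalar, and a nonzero scalar in the
radical would put the identity there. -/
theorem catRadical_eq (h2 : ∀ x y : W, ∀ r ∈ S x y, ∀ p ∈ r.support, 2 ≤ p.length)
    (h : ∃ m : ℕ, ∀ x y : W, pathsGE k m x y ≤ S.ideal.carrier (pathObj k x) (pathObj k y)) (x y : W) :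
    catRadical k (S.vtx x) (S.vtx y) = S.arrowIdeal x y := by
  have hle : ∀ x y, S.arrowIdeal x y ≤ catRadical k (S.vtx x) (S.vtx y) := by
    intro x y f hf g
    rw [← Ideal.jacobson_bot, Ideal.mem_jacobson_iff]
    intro q
    have hn : IsNilpotent (q * (show End (S.vtx x) from f ≫ g)) :=
      isNilpotent_of_mem_arrowIdeal h (arrowIdeal_comp _ (arrowIdeal_comp g hf))
    obtain ⟨z, hz⟩ := hn.isUnit_one_add
    refine ⟨↑z⁻¹, ?_⟩
    rw [Ideal.mem_bot, mul_assoc, sub_eq_zero]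
    calc ↑z⁻¹ * (q * (show End (S.vtx x) from f ≫ g)) + ↑z⁻¹
        = ↑z⁻¹ * (1 + q * (show End (S.vtx x) from f ≫ g)) := by
          rw [mul_add, mul_one, add_comm]
      _ = 1 := by rw [← hz, Units.inv_mul]
  refine le_antisymm (fun f hf => ?_) (hle x y)
  by_cases hxy : x = y
  · subst hxy
    obtain ⟨c, hc⟩ := exists_sub_smul_mem_arrowIdeal f
    have hc0 : c = 0 := by
      by_contra hc0
      have h1 := sub_mem hf (hle x x hc)
      rw [sub_sub_cancel, Submodule.smul_mem_iff _ hc0] at h1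
      have h3 := h1 (𝟙 _)
      rw [Category.comp_id, ← Ideal.jacobson_bot, Ideal.mem_jacobson_iff] at h3
      -- With multiplier -1 the quasi-inverse equation for the identity reads -z + z - 1 = 0.
      obtain ⟨z, hz⟩ := h3 (-1)
      rw [Ideal.mem_bot] at hz
      have h4 : (show End (S.vtx x) from 𝟙 _) = 1 := rfl
      rw [h4, mul_one, mul_neg, mul_one, neg_add_cancel, zero_sub, neg_eq_zero] at hz
      have h5 : 𝟙 (S.vtx x) = 0 := hz
      exact id_notMem_arrowIdeal h2 x (h5 ▸ Submodule.zero_mem _)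
    subst hc0
    simpa using hc
  · rw [arrowIdeal_of_ne hxy]
    exact Submodule.mem_top

theorem radPow_one (h2 : ∀ x y : W, ∀ r ∈ S x y, ∀ p ∈ r.support, 2 ≤ p.length)
    (h : ∃ m : ℕ, ∀ x y : W, pathsGE k m x y ≤ S.ideal.carrier (pathObj k x) (pathObj k y)) (x y : W) :
    radPow k 1 (S.vtx x) (S.vtx y) = S.arrowIdeal x y := by
  refine le_antisymm (Submodule.span_le.2 ?_) fun f hf => ?_
  · rintro _ ⟨⟨(z : W)⟩, f, g, -, hg, rfl⟩
    exact comp_arrowIdeal f ((catRadical_eq h2 h z y).le hg)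
  · exact Submodule.subset_span
      ⟨S.vtx x, 𝟙 _, f, Submodule.mem_top, (catRadical_eq h2 h x y).ge hf, (Category.id_comp f).symm⟩

theorem finiteDimensional_hom [Finite W] [∀ x y : W, Finite (x ⟶ y)]
    (h : ∃ m : ℕ, ∀ x y : W, pathsGE k m x y ≤ S.ideal.carrier (pathObj k x) (pathObj k y)) (X Y : S.Cat) :
    FiniteDimensional k (X ⟶ Y) := by
  obtain ⟨(x : W)⟩ := X
  obtain ⟨(y : W)⟩ := Y
  obtain ⟨m, hm⟩ := h
  refine ⟨Submodule.fg_def.2 ⟨(fun p : Quiver.Path x y => S.qmap x y (pathHom k p)) '' {p | p.length < m},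
    (Quiver.Path.finite_length_lt x m y).image _, eq_top_iff.2 fun f _ => ?_⟩⟩
  obtain ⟨f, rfl⟩ := qmap_surjective x y f
  refine pathHom_induction (T := (Submodule.span k _).comap (S.qmap x y)) (fun p => ?_) f
  by_cases hp : p.length < m
  · exact Submodule.subset_span ⟨p, hp, rfl⟩
  · rw [Submodule.mem_comap, qmap_eq_zero.2 (hm x y (pathHom_mem (by omega)))]
    exact Submodule.zero_mem _

theorem finite_cat [Finite W] : Finite S.Cat :=
  Finite.of_injective (β := W) (fun X => X.obj) fun ⟨_⟩ ⟨_⟩ h => congrArg _ h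

end QuiverRelations

end Paths

/-! ## The extended quiver -/

section Tilde

theorem TildeVertex.finite {V : Type u} [Finite V] : Finite (TildeVertex V) :=
  Finite.of_surjective (fun p : V ⊕ V => p.elim TildeVertex.old TildeVertex.new) fun
    | .old x => ⟨.inl x, rfl⟩
    | .new x => ⟨.inr x, rfl⟩

variable {k : Type w} [Field k] {V : Type u} [Quiver.{v} V]

theorem TildeVertex.finite_hom [∀ x y : V, Finite (x ⟶ y)] :
    ∀ X Y : TildeVertex V, Finite (X ⟶ Y)
  | .old x, .old y => Finite.of_surjective (fun a : x ⟶ y => (TildeArrow.old a : TildeArrow V _ _))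
      fun | .old a => ⟨a, rfl⟩
  | .old x, .new y => by
      have : Subsingleton (TildeArrow V (.old x) (.new y)) :=
        ⟨fun a b => by cases a; cases b; rfl⟩
      exact inferInstanceAs (Finite (TildeArrow V (.old x) (.new y)))
  | .new x, Y => by
      have : IsEmpty (TildeArrow V (.new x) Y) := ⟨fun a => by cases a⟩
      exact inferInstanceAs (Finite (TildeArrow V (.new x) Y))

namespace TildeVertex

theorem path_from_new {x : V} : ∀ {Y : TildeVertex V} (p : Quiver.Path (.new x) Y), p.length = 0
  | _, .nil => rfl
  | _, .cons (b := b) p a => by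
      have h := path_from_new p
      obtain rfl := Quiver.Path.eq_of_length_zero p h
      exact nomatch (show TildeArrow V _ _ from a)

/-- The new arrow at a vertex. -/
abbrev newArrow (x : V) : (TildeVertex.old x : TildeVertex V) ⟶ .new x := TildeArrow.new x

theorem path_to_new {X : TildeVertex V} {x : V} (p : Quiver.Path X (.new x)) :
    p.length = 0 ∨ ∃ q : Quiver.Path X (.old x), p = q.cons (newArrow x) := by
  cases p with
  | nil => exact .inl rfl
  | cons q a =>
    obtain a : TildeArrow V _ _ := a
    cases a
    exact .inr ⟨q, rfl⟩

/-- A path of the quiver as a path of the extended quiver. -/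
def oldPath {x y : V} (p : Quiver.Path x y) :
    Quiver.Path (TildeVertex.old x : TildeVertex V) (.old y) :=
  (tildeInclusion V).mapPath p

theorem length_oldPath {x y : V} (p : Quiver.Path x y) : (oldPath p).length = p.length := by
  induction p with
  | nil => rfl
  | cons p a ih => exact congrArg (· + 1) ih

theorem oldPath_comp {x y z : V} (p : Quiver.Path x y) (q : Quiver.Path y z) :
    oldPath (p.comp q) = (oldPath p).comp (oldPath q) :=
  Prefunctor.mapPath_comp _ _ _

/-- An arrow that ends in an old vertex is old. The equality `Y = .old y` keeps the endpoint free
for the induction. -/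
theorem exists_oldPath {x : V} : ∀ {Y : TildeVertex V} (p : Quiver.Path (.old x) Y) {y : V},
    (hY : Y = .old y) → ∃ q : Quiver.Path x y, oldPath q = hY ▸ p := by
  intro Y p
  induction p with
  | nil =>
    intro y hY
    cases hY
    exact ⟨.nil, rfl⟩
  | cons p a ih =>
    intro y hY
    subst hY
    obtain a : TildeArrow V _ _ := a
    cases a with
    | old a =>
      obtain ⟨q, hq⟩ := ih rfl
      obtain rfl : _ = p := hq
      exact ⟨q.cons a, rfl⟩

end TildeVertex

namespace QuiverRelations

open TildeVertex

variable {R : QuiverRelations k V}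

theorem two_le_length_of_tilde (h : ∀ x y : V, ∀ r ∈ R x y, ∀ p ∈ r.support, 2 ≤ p.length)
    (X Y : TildeVertex V) : ∀ r ∈ R.tilde X Y, ∀ p ∈ r.support, 2 ≤ p.length := by
  classical
  rintro r (⟨r, hr⟩) p hp
  obtain ⟨q, hq, rfl⟩ := Finset.mem_image.1 (Finsupp.mapDomain_support hp)
  exact (h _ _ r hr q hq).trans (length_oldPath q).ge

/-- The map from combinations of paths to those of the extended quiver. -/
noncomputable def tildeMap (k : Type w) [Field k] (x y : V) :
    PathComb k x y →ₗ[k] PathComb k (TildeVertex.old x) (TildeVertex.old y) :=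
  Finsupp.lmapDomain k k oldPath

theorem tildeMap_pathHom {x y : V} (p : Quiver.Path x y) :
    tildeMap k x y (pathHom k p) = pathHom k (oldPath p) :=
  Finsupp.mapDomain_single

theorem tildeMap_comp {x y z : V} (f : PathComb k x y) (g : PathComb k y z) :
    tildeMap k x z (f ≫ g) = tildeMap k x y f ≫ tildeMap k y z g := by
  have h1 : ∀ p : Quiver.Path x y,
      tildeMap k x z (pathHom k p ≫ g) = tildeMap k x y (pathHom k p) ≫ tildeMap k y z g := by
    intro p
    refine pathHom_induction (T := LinearMap.eqLocus
      (tildeMap k x z ∘ₗ Linear.leftComp k (pathObj k z) (pathHom k p))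
      (Linear.leftComp k (pathObj k (TildeVertex.old z)) (tildeMap k x y (pathHom k p)) ∘ₗ
        tildeMap k y z)) (fun q => ?_) g
    change tildeMap k x z (pathHom k p ≫ pathHom k q) =
      tildeMap k x y (pathHom k p) ≫ tildeMap k y z (pathHom k q)
    rw [pathHom_comp, tildeMap_pathHom, tildeMap_pathHom, tildeMap_pathHom, pathHom_comp,
      oldPath_comp]
  exact pathHom_induction (T := LinearMap.eqLocus
      (tildeMap k x z ∘ₗ Linear.rightComp k (pathObj k x) g)
      (Linear.rightComp k (pathObj k (TildeVertex.old x)) (tildeMap k y z g) ∘ₗ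
        tildeMap k x y)) h1 f

theorem tildeMap_mem {x y : V} {f : PathComb k x y}
    (hf : f ∈ R.ideal.carrier (pathObj k x) (pathObj k y)) :
    tildeMap k x y f ∈ R.tilde.ideal.carrier (pathObj k (.old x)) (pathObj k (.old y)) := by
  refine (Submodule.span_le (p := (R.tilde.ideal.carrier (pathObj k (TildeVertex.old x))
    (pathObj k (TildeVertex.old y))).comap (tildeMap k x y))).2 ?_ hf
  rintro _ ⟨(A : V), (B : V), (f : PathComb k x A), (r : PathComb k A B), (g : PathComb k B y),
    hr, rfl⟩
  rw [SetLike.mem_coe, Submodule.mem_comap]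
  rw [tildeMap_comp, tildeMap_comp]
  exact Submodule.subset_span ⟨.old A, .old B, tildeMap k x A f, tildeMap k A B r,
    tildeMap k B y g, TildeRel.old r hr, rfl⟩

/-- A new arrow can only be the last arrow of a path, so the length bound m becomes m + 1. -/
theorem tilde_pathsGE_le (h : ∃ m : ℕ, ∀ x y : V, pathsGE k m x y ≤
      R.ideal.carrier (pathObj k x) (pathObj k y)) :
    ∃ m : ℕ, ∀ X Y : TildeVertex V,
      pathsGE k m X Y ≤ R.tilde.ideal.carrier (pathObj k X) (pathObj k Y) := by
  obtain ⟨m, hm⟩ := h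
  have hold : ∀ (X : TildeVertex V) (y : V) (p : Quiver.Path X (.old y)), m ≤ p.length →
      pathHom k p ∈ R.tilde.ideal.carrier (pathObj k X) (pathObj k (.old y)) := by
    intro X y p hp
    cases X with
    | old x =>
      obtain ⟨q, hq⟩ := exists_oldPath p rfl
      obtain rfl : _ = p := hq
      rw [← tildeMap_pathHom]
      refine tildeMap_mem (hm x y (pathHom_mem ?_))
      rwa [length_oldPath] at hp
    | new x => exact nomatch Quiver.Path.eq_of_length_zero p (path_from_new p)
  refine ⟨m + 1, fun X Y => pathsGE_induction fun p hp => ?_⟩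
  cases Y with
  | old y => exact hold X y p (by omega)
  | new y =>
    rcases path_to_new p with h0 | ⟨q, rfl⟩
    · omega
    · have e : pathHom k (q.cons (newArrow y)) = pathHom k q ≫ pathHom k (newArrow y).toPath := by
        rw [pathHom_comp]
        rfl
      rw [e]
      refine R.tilde.ideal.mem_comp _ (hold X y q ?_)
      rw [Quiver.Path.length_cons] at hp
      omega

open Classical in
/-- Removal of the last arrow from combinations of paths that end in a new vertex. -/
noncomputable def strip (k : Type w) [Field k] (X : TildeVertex V) (x : V) :
    PathComb k X (TildeVertex.new x) →ₗ[k] PathComb k X (TildeVertex.old x) :=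
  Finsupp.linearCombination k fun p : Quiver.Path X (.new x) =>
    if h : ∃ q : Quiver.Path X (.old x), p = q.cons (newArrow x) then pathHom k h.choose else 0

theorem strip_cons {X : TildeVertex V} {x : V} (q : Quiver.Path X (.old x)) :
    strip k X x (pathHom k (q.cons (newArrow x))) = pathHom k q := by
  have h : ∃ q' : Quiver.Path X (.old x), q.cons (newArrow x) = q'.cons (newArrow x) := ⟨q, rfl⟩
  refine (Finsupp.linearCombination_single k (1 : k) (q.cons (newArrow x))).trans ?_
  rw [one_smul, dif_pos h]
  congr 1
  exact (Quiver.Path.cons.inj h.choose_spec).2.1.symm |> eq_of_heq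

theorem strip_comp_newArrow {X : TildeVertex V} {x : V} (f : PathComb k X (TildeVertex.old x)) :
    strip k X x (f ≫ pathHom k (newArrow x).toPath) = f := by
  refine pathHom_induction (T := LinearMap.eqLocus
    (strip k X x ∘ₗ Linear.rightComp k (pathObj k X) (pathHom k (newArrow x).toPath))
    LinearMap.id) (fun q => ?_) f
  change strip k X x (pathHom k q ≫ pathHom k (newArrow x).toPath) = pathHom k q
  rw [pathHom_comp]
  exact strip_cons q

theorem strip_comp {X : TildeVertex V} {y x : V} (f : PathComb k X (TildeVertex.old y))
    (g : PathComb k (TildeVertex.old y) (TildeVertex.new x)) :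
    strip k X x (f ≫ g) = f ≫ strip k (.old y) x g := by
  refine pathHom_induction (T := LinearMap.eqLocus
    (strip k X x ∘ₗ Linear.leftComp k (pathObj k (TildeVertex.new x)) f)
    (Linear.leftComp k (pathObj k (TildeVertex.old x)) f ∘ₗ strip k (.old y) x)) (fun q => ?_) g
  change strip k X x (f ≫ pathHom k q) = f ≫ strip k (.old y) x (pathHom k q)
  rcases path_to_new q with h | ⟨q, rfl⟩
  · exact nomatch Quiver.Path.eq_of_length_zero q h
  · have e : pathHom k (q.cons (newArrow x)) = pathHom k q ≫ pathHom k (newArrow x).toPath := by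
      rw [pathHom_comp]
      rfl
    rw [strip_cons, e, ← Category.assoc, strip_comp_newArrow]

/-- Every relation ends in an old vertex. In a generator f ≫ r ≫ g ending in a new vertex, the new
arrow therefore belongs to g, and stripping it leaves an element of the ideal. -/
theorem strip_mem {X : TildeVertex V} {x : V} {f : PathComb k X (TildeVertex.new x)}
    (hf : f ∈ R.tilde.ideal.carrier (pathObj k X) (pathObj k (.new x))) :
    strip k X x f ∈ R.tilde.ideal.carrier (pathObj k X) (pathObj k (.old x)) := by
  refine (Submodule.span_le (p := (R.tilde.ideal.carrier (pathObj k X)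
    (pathObj k (TildeVertex.old x))).comap (strip k X x))).2 ?_ hf
  rintro _ ⟨(A : TildeVertex V), (B : TildeVertex V), (f : PathComb k X A), (r : PathComb k A B),
    (g : PathComb k B (TildeVertex.new x)), hr, rfl⟩
  rw [SetLike.mem_coe, Submodule.mem_comap]
  obtain hr : R.TildeRel A B r := hr
  obtain ⟨b, rfl⟩ : ∃ b, B = .old b := by
    cases hr
    exact ⟨_, rfl⟩
  have e : strip k X x (f ≫ r ≫ g) = f ≫ r ≫ strip k _ x g := by
    rw [← Category.assoc, strip_comp (f ≫ r) g, Category.assoc]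
  refine e ▸ ?_
  exact Submodule.subset_span ⟨A, .old b, f, r, strip k _ x g, hr, rfl⟩

/-- `strip` is a left inverse of composition with the new arrow and respects the relations, so this
composition stays injective in Ã. -/
theorem eq_zero_of_comp_newArrow {X : TildeVertex V} {x : V}
    {f : R.tilde.vtx X ⟶ R.tilde.vtx (.old x)}
    (hf : f ≫ R.tilde.qmap _ _ (pathHom k (newArrow x).toPath) = 0) : f = 0 := by
  obtain ⟨f, rfl⟩ := qmap_surjective _ _ f
  rw [qmap_comp, qmap_eq_zero] at hf
  rw [qmap_eq_zero, ← strip_comp_newArrow f]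
  exact strip_mem hf

theorem isTildeLike [Finite V] [∀ x y : V, Finite (x ⟶ y)] (hR : R.IsAdmissible) {N : ℕ}
    (hN : ∀ X Y : R.ACatTilde, (radFiltration k R.ACatTilde).ideal N X Y = ⊥) :
    (radFiltration k R.ACatTilde).IsTildeLike N fun X => ∃ x, X.obj = TildeVertex.new x := by
  have := TildeVertex.finite (V := V)
  have := TildeVertex.finite_hom (V := V)
  have h2 := two_le_length_of_tilde hR.1
  have h := tilde_pathsGE_le (pathsGE_le hR.2)
  have hone : ∀ X Y : TildeVertex V, (radFiltration k R.ACatTilde).ideal 1 (R.tilde.vtx X)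
      (R.tilde.vtx Y) = R.tilde.arrowIdeal X Y := radPow_one h2 h
  have hid : ∀ X : TildeVertex V, 𝟙 (R.tilde.vtx X) ∉ R.tilde.arrowIdeal X X :=
    id_notMem_arrowIdeal h2
  have hnew : ∀ (x : V) (Y : TildeVertex V), .new x ≠ Y →
      ∀ f : R.tilde.vtx (.new x) ⟶ R.tilde.vtx Y, f = 0 := by
    intro x Y hY f
    obtain ⟨f, rfl⟩ := qmap_surjective _ _ f
    refine pathHom_induction (T := LinearMap.ker (R.tilde.qmap (.new x) Y)) (fun p => ?_) f
    exact absurd (Quiver.Path.eq_of_length_zero p (path_from_new p)) hY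
  have harrow : ∀ (x : V), R.tilde.arrowIdeal (.new x) (.new x) = ⊥ := by
    refine fun x => (Submodule.eq_bot_iff _).2 ?_
    rintro _ ⟨f, hf, rfl⟩
    refine pathsGE_induction (T := LinearMap.ker (R.tilde.qmap (.new x) (.new x)))
      (fun p hp => ?_) hf
    have := path_from_new p
    omega
  have hα : ∀ x : V, R.tilde.qmap _ _ (pathHom k (newArrow x).toPath) ≠ 0 := by
    intro x h0
    have h1 := ideal_le h2 _ _ (qmap_eq_zero.1 h0)
    rw [pathHom_mem_iff] at h1
    simp at h1
  -- The new arrow is a nonzero element of I_1, so I_1 ≠ 0. This gives N - 1 ≥ 1, needed for I_{N-1}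
  -- ⊆ I_1 at new vertices.
  have hN2 : ∀ x : V, 2 ≤ N := by
    intro x
    by_contra hlt
    have h1 := (radFiltration k R.ACatTilde).anti (show N ≤ 1 by omega) (R.tilde.vtx (.old x))
      (R.tilde.vtx (.new x))
    rw [hN, hone, arrowIdeal_of_ne (by simp)] at h1
    exact hα x ((Submodule.mem_bot k).1 (h1 Submodule.mem_top))
  refine ⟨finite_cat, finiteDimensional_hom h, hN, ?_, ?_, ?_, ?_, ?_, ?_⟩
  · rintro ⟨(X : TildeVertex V)⟩ ⟨(Y : TildeVertex V)⟩ hXY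
    exact (hone X Y).trans (arrowIdeal_of_ne fun h => hXY (by rw [h]))
  · rintro ⟨(X : TildeVertex V)⟩ f
    obtain ⟨c, hc⟩ := exists_sub_smul_mem_arrowIdeal f
    exact ⟨c, (hone X X).ge hc⟩
  · rintro ⟨(X : TildeVertex V)⟩ h1
    exact hid X ((hone X X).le h1)
  · rintro ⟨(X : TildeVertex V)⟩ hX ⟨(Y : TildeVertex V)⟩
    cases X with
    | new x => exact (hX ⟨x, rfl⟩).elim
    | old x =>
      -- Following `f` by the new arrow raises its degree from N - 1 to N, where everything is zero.
      refine (Submodule.eq_bot_iff _).2 fun f hf => eq_zero_of_comp_newArrow ?_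
      have h1 := (radFiltration k R.ACatTilde).mul (N - 1) 1 hf
        (g := R.tilde.qmap _ _ (pathHom k (newArrow x).toPath))
        ((hone _ _).ge ⟨_, pathHom_mem (by simp), rfl⟩)
      rw [Nat.sub_add_cancel (by have := hN2 x; omega), hN] at h1
      exact (Submodule.mem_bot k).1 h1
  · rintro ⟨(X : TildeVertex V)⟩ ⟨x, hX⟩ ⟨(Y : TildeVertex V)⟩
    obtain rfl : X = .new x := hX
    by_cases hY : .new x = Y
    · subst hY
      -- No path of positive length leaves a new vertex, so I_1, and with it I_{N-1}, vanishes on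
      -- its endomorphisms.
      refine eq_bot_iff.2 (le_trans ((radFiltration k R.ACatTilde).anti
        (show 1 ≤ N - 1 by have := hN2 x; omega) _ _) ?_)
      exact ((hone _ _).trans (harrow x)).le
    · exact (Submodule.eq_bot_iff _).2 fun f _ => hnew x Y hY f
  · rintro ⟨(X : TildeVertex V)⟩ ⟨(Y : TildeVertex V)⟩ ⟨x, hX⟩ - hXY f
    obtain rfl : X = .new x := hX
    exact hnew x Y (fun h => hXY (by rw [h])) f

end QuiverRelations

end Tilde

theorem corollary3p4 {k : Type w} [Field k] [IsAlgClosed k] {V : Type u} [Finite V]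
    [Quiver.{v} V] [∀ x y : V, Finite (x ⟶ y)] (R : QuiverRelations k V)
    (hR : R.IsAdmissible) (N : ℕ)
    (hN : IsLeast {m : ℕ | ∀ X Y : R.ACatTilde,
      (radFiltration k R.ACatTilde).ideal m X Y = ⊥} N) :
    IsQuasiHereditary k (R.DCat N) (R.secondLT N) := by
  have h := (QuiverRelations.isTildeLike hR hN.1).isQuasiHereditary
  -- The two descriptions of the order differ only in saying "old" or "not new".
  convert h using 1
  ext Y X
  refine or_congr Iff.rfl (and_congr Iff.rfl (and_congr_left' ?_))
  change (∃ y, QuiverRelations.DCat.vertex Y = .old y) ↔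
    ¬ ∃ y, QuiverRelations.DCat.vertex Y = .new y
  cases QuiverRelations.DCat.vertex Y <;> simp
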